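/- Let $p,q\in\mathbb{R}\setminus\{0\}$ and let $P:\mathbb{R}\to\mathbb{R}$ be a Schwartz function of compact support. Notation. For $X\in\mathbb{R}$ put $D_XP(k)=\frac{P(k+X/2)-P(k-X/2)}{X}$ if $X\neq 0$ and $D_0P(k)=P'(k)$. Let $\mathbb{H}[u](\Omega)=\frac1\pi\int_{\mathbb{R}}\frac{u(t)}{\Omega-t}\,dt$, as an ordinary integral for $\Omega\in\mathbb{C}\setminus\mathbb{R}$ and as a principal value for $\Omega\in\mathbb{R}$, and let $\mathbb{S}[u](x)=\mathbb{H}[u](x)-i\,u(x)$ for $x\in\mathbb{R}$. Let $$h(X,t)=2q\,\sin(2\pi^2pX^2t)\,\check P(2\pi pXt),\quad \check P(y)=\int_{\mathbb{R}}e^{2\pi i yk}P(k)\,dk,\qquad \tilde h(X,\omega)=\int_0^\infty e^{-\omega t}h(X,t)\,dt .$$ $P$ is called stable if there is $\kappa>0$ with $\inf_{\operatorname{Re}\omega>0,\;X\in\mathbb{R}}|1-\tilde h(X,\omega)|\geq\kappa$. Let $\Gamma_X=\{\mathbb{S}[D_XP](t):t\in\mathbb{R}\}\cup\{0\}$, regarded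 as the closed curve $t\mapsto\mathbb{S}[D_XP](t)$, $t\in\mathbb{R}$, which starts and ends at its limit $0$ as $t\to\pm\infty$; a point $z\in\mathbb{C}\setminus\Gamma_X$ is enclosed by $\Gamma_X$ if the winding number of this curve around $z$ is non-zero. Let $\overset{\circ}{\Gamma}_X$ be the set of points enclosed by $\Gamma_X$, and let $\overline\Gamma$ be the closure of $\bigcup_{X\in\mathbb{R}}\overset{\circ}{\Gamma}_X$. Theorem. The principal values $\mathbb{H}[D_XP](t)$ exist for all $X,t\in\mathbb{R}$, and the following are equivalent: (A) $\inf_{\operatorname{Re}\omega>0,\;X\in\mathbb{R}}|1-\tilde h(X,\omega)|=0$, i.e. $P$ is not stable. (B) Either there exist $X_*\in\mathbb{R}$ and $\Omega_*\in\mathbb{C}\setminus\mathbb{R}$ such that $\mathbb{H}[D_{X_*}P](\Omega_*)=\mathbb{H}[D_{X_*}P](\overline{\Omega_*})=\frac{4\pi p}{q}$, or there exist $X_*,\Omega_*\in\mathbb{R}$ such that $\mathbb{H}[D_{X_*}P](\Omega_*)=\frac{4\pi p}{q}$ and $D_{X_*}P(\Omega_*)=0$. (C) $d(\overline\Gamma,4\pi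 p/q)=0$ (where $d(\emptyset,\cdot)=\infty$), i.e. $4\pi p/q\in\overline\Gamma$. Moreover, if $\mathbb{H}[D_XP](t_*)<\frac{4\pi p}{q}$ for all $X,t_*\in\mathbb{R}$ with $D_XP(t_*)=0$, then $P$ is stable. -/

import Mathlib

open Filter Topology MeasureTheory
open scoped SchwartzMap FourierTransform ComplexConjugate

noncomputable section

namespace Alber

/-- The divided difference `D_X P`. -/
def divDiff (P : ℝ → ℝ) (X : ℝ) (k : ℝ) : ℝ :=
  if X = 0 then deriv P k else (P (k + X / 2) - P (k - X / 2)) / X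

/-- The truncated integral `(1/π) ∫_{|x-t|>ε} u(t)/(x-t) dt` whose limit as `ε ↓ 0` is the
Hilbert transform. -/
def hilbertTrunc (u : ℝ → ℝ) (x ε : ℝ) : ℝ :=
  Real.pi⁻¹ * ∫ t in {t : ℝ | ε < |x - t|}, u t / (x - t)

/-- The Hilbert transform `H[u](x)` at a real point, as a principal value. -/
def hilbert (u : ℝ → ℝ) (x : ℝ) : ℝ :=
  limUnder (𝓝[>] 0) (hilbertTrunc u x)

/-- The Hilbert transform `H[u](Ω)` at a non-real point `Ω`, where the integral is an
ordinary (absolutely convergent) one. -/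
def hilbertOff (u : ℝ → ℝ) (Ω : ℂ) : ℂ :=
  (Real.pi : ℂ)⁻¹ * ∫ t : ℝ, (u t : ℂ) / (Ω - t)

/-- The signal transform `S[u] = H[u] - i u` on the real line. -/
def signal (u : ℝ → ℝ) (x : ℝ) : ℂ :=
  (hilbert u x : ℂ) - Complex.I * (u x : ℂ)

/-- The kernel `h(X,t) = 2q sin(2π²pX²t) P̌(2πpXt)`, where
`P̌(y) = ∫ e^{2πiyk} P(k) dk`. -/
def kernel (P : ℝ → ℝ) (p q X t : ℝ) : ℂ :=
  2 * (q : ℂ) * (Real.sin (2 * Real.pi ^ 2 * p * X ^ 2 * t) : ℂ) *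
    (𝓕⁻ (fun k : ℝ => (P k : ℂ))) (2 * Real.pi * p * X * t)

/-- The Laplace transform `h̃(X,ω) = ∫_0^∞ e^{-ωt} h(X,t) dt`. -/
def kernelLaplace (P : ℝ → ℝ) (p q X : ℝ) (ω : ℂ) : ℂ :=
  ∫ t in Set.Ioi (0 : ℝ), Complex.exp (-ω * t) * kernel P p q X t

/-- The infimum of `|1 - h̃(X,ω)|` over `X ∈ ℝ`, `Re ω > 0`. -/
def penroseInf (P : ℝ → ℝ) (p q : ℝ) : ℝ :=
  ⨅ z : ℝ × {ω : ℂ // 0 < ω.re}, ‖1 - kernelLaplace P p q z.1 z.2‖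

/-- The spectrum `P` is stable. -/
def IsStable (P : ℝ → ℝ) (p q : ℝ) : Prop :=
  ∃ κ : ℝ, 0 < κ ∧ κ ≤ penroseInf P p q

/-- The curve `Γ_X`, as a set: the values of `S[D_X P]` on the line, together with its limit `0`
at `±∞`. -/
def curveSet (P : ℝ → ℝ) (X : ℝ) : Set ℂ :=
  Set.range (signal (divDiff P X)) ∪ {0}

/-- The curve `γ : ℝ → ℂ`, closed up by its common limit at `±∞`, has winding number `n`
around `z`: there is a continuous branch `L` of `log (γ - z)` on the extended line, and it
increases by `2πin` from `-∞` to `+∞`. -/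
def HasWindingNumber (γ : ℝ → ℂ) (z : ℂ) (n : ℤ) : Prop :=
  ∃ L : ℝ → ℂ, Continuous L ∧ (∀ t, γ t - z = Complex.exp (L t)) ∧
    ∃ a : ℂ, Tendsto L atBot (𝓝 a) ∧ Tendsto L atTop (𝓝 (a + 2 * Real.pi * Complex.I * n))

/-- The points enclosed by `Γ_X`: the points off the curve around which it winds. -/
def enclosed (P : ℝ → ℝ) (X : ℝ) : Set ℂ :=
  {z | z ∉ curveSet P X ∧ ∃ n : ℤ, n ≠ 0 ∧ HasWindingNumber (signal (divDiff P X)) z n}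

/-- The closure of the union over all `X` of the regions enclosed by `Γ_X`. -/
def enclosedClosure (P : ℝ → ℝ) : Set ℂ :=
  closure (⋃ X : ℝ, enclosed P X)

end Alber

/-!
Writing `F_X = H[D_X P]` on the upper half-plane as a half-line Fourier transform of
`sin (πXξ) / (πX) · P̂(ξ)` shows that `F_X` is holomorphic, extends to the real line by
`S[D_X P]`, and that the extension is jointly continuous in `(X, Ω)`; integration by parts in `ξ`
bounds it by a multiple of `1 / |Ω|` uniformly in `X`, and the factor `1 / X` bounds it by a
multiple of `1 / |X|`.

Up to the factor `q / (4πp)` and conjugation the values of `h̃` are values of `F_X`, so (A) says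
that `c = 4πp/q` lies in the closure of the set of all `F_X(Ω)`. By the decay this set is closed
away from `0`, hence `c` is attained, which is (B). By the argument principle `Γ_X` encloses exactly
the values of `F_X` on the open half-plane that lie off `Γ_X`. The image of the half-plane is open
(or `{0}`) and the smooth curve `Γ_X` has dense complement, so nothing but possibly `0` is lost in
the closure, which gives (C).

In the last claim, `D_X P` vanishes somewhere for arbitrarily large `X`, where `H[D_X P]` is close
to `0`; hence `c > 0`. Then `c - S[D_X P]` avoids the negative real axis, so that `Γ_X` does not
wind around `c` and `c` is not a value of `F_X`.
-/

namespace Alber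

/-! ### Half-line Fourier transforms -/

/-- The half-line Fourier transform `∫_0^∞ e^{2πiΩξ} φ(ξ) dξ`, which is holomorphic for `Ω` in the
upper half-plane. -/
def fourierLaplace (φ : ℝ → ℂ) (Ω : ℂ) : ℂ :=
  ∫ ξ in Set.Ioi (0 : ℝ), Complex.exp (2 * Real.pi * Complex.I * Ω * ξ) * φ ξ

lemma norm_exp_two_pi_I_mul (Ω : ℂ) (ξ : ℝ) :
    ‖Complex.exp (2 * Real.pi * Complex.I * Ω * ξ)‖ = Real.exp (-(2 * Real.pi * Ω.im * ξ)) := by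
  rw [Complex.norm_exp]
  congr 1
  simp [mul_assoc]

lemma norm_exp_two_pi_I_mul_le_one {Ω : ℂ} (hΩ : 0 ≤ Ω.im) {ξ : ℝ} (hξ : 0 ≤ ξ) :
    ‖Complex.exp (2 * Real.pi * Complex.I * Ω * ξ)‖ ≤ 1 := by
  rw [norm_exp_two_pi_I_mul, Real.exp_le_one_iff, neg_nonpos]
  positivity

lemma norm_exp_two_pi_I_mul_mul_le (c : ℂ) {Ω : ℂ} (hΩ : 0 ≤ Ω.im) {ξ : ℝ} (hξ : 0 ≤ ξ) :
    ‖Complex.exp (2 * Real.pi * Complex.I * Ω * ξ) * c‖ ≤ ‖c‖ := by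
  rw [norm_mul]
  exact mul_le_of_le_one_left (norm_nonneg c) (norm_exp_two_pi_I_mul_le_one hΩ hξ)

lemma aestronglyMeasurable_exp_mul {φ : ℝ → ℂ} {μ : Measure ℝ} (hφ : AEStronglyMeasurable φ μ)
    (Ω : ℂ) :
    AEStronglyMeasurable
      (fun ξ : ℝ => Complex.exp (2 * Real.pi * Complex.I * Ω * ξ) * φ ξ) μ :=
  (Continuous.aestronglyMeasurable (by fun_prop)).mul hφ

lemma integrableOn_exp_mul {φ : ℝ → ℂ} (hφ : IntegrableOn φ (Set.Ioi 0)) {Ω : ℂ}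
    (hΩ : 0 ≤ Ω.im) :
    IntegrableOn (fun ξ : ℝ => Complex.exp (2 * Real.pi * Complex.I * Ω * ξ) * φ ξ)
      (Set.Ioi 0) :=
  Integrable.mono hφ (aestronglyMeasurable_exp_mul hφ.1 Ω) <|
    (ae_restrict_mem measurableSet_Ioi).mono fun _ hξ => norm_exp_two_pi_I_mul_mul_le _ hΩ hξ.le

lemma norm_fourierLaplace_le {φ : ℝ → ℂ} (hφ : IntegrableOn φ (Set.Ioi 0)) {Ω : ℂ}
    (hΩ : 0 ≤ Ω.im) : ‖fourierLaplace φ Ω‖ ≤ ∫ ξ in Set.Ioi (0 : ℝ), ‖φ ξ‖ :=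
  norm_integral_le_of_norm_le hφ.norm <|
    (ae_restrict_mem measurableSet_Ioi).mono fun _ hξ => norm_exp_two_pi_I_mul_mul_le _ hΩ hξ.le

lemma two_pi_mul_fourierLaplace {φ φ' : ℝ → ℂ} (hφ : IntegrableOn φ (Set.Ioi 0))
    (hφ' : IntegrableOn φ' (Set.Ioi 0)) (hderiv : ∀ ξ, HasDerivAt φ (φ' ξ) ξ) (h0 : φ 0 = 0)
    {Ω : ℂ} (hΩ : 0 ≤ Ω.im) :
    2 * Real.pi * Complex.I * Ω * fourierLaplace φ Ω = -fourierLaplace φ' Ω := by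
  set a : ℂ := 2 * Real.pi * Complex.I * Ω
  have hexp (ξ : ℝ) :
      HasDerivAt (fun ξ : ℝ => Complex.exp (a * ξ)) (a * Complex.exp (a * ξ)) ξ := by
    simpa [mul_comm] using ((hasDerivAt_id ξ).ofReal_comp.const_mul a).cexp
  have hprod_deriv (ξ : ℝ) : HasDerivAt (fun ξ : ℝ => Complex.exp (a * ξ) * φ ξ)
      (a * (Complex.exp (a * ξ) * φ ξ) + Complex.exp (a * ξ) * φ' ξ) ξ := by
    rw [← mul_assoc]
    exact (hexp ξ).mul (hderiv ξ)
  have hint := integrableOn_exp_mul hφ hΩ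
  have hint' := integrableOn_exp_mul hφ' hΩ
  have hsum := (hint.const_mul a).add hint'
  have hlim := tendsto_zero_of_hasDerivAt_of_integrableOn_Ioi
    (fun ξ (_ : ξ ∈ Set.Ioi 0) => hprod_deriv ξ) hsum hint
  have hftc := integral_Ioi_of_hasDerivAt_of_tendsto' (fun ξ _ => hprod_deriv ξ) hsum hlim
  rw [integral_add (hint.const_mul a) hint', integral_const_mul, h0, mul_zero, sub_zero] at hftc
  exact eq_neg_of_add_eq_zero_left hftc

lemma norm_mul_norm_fourierLaplace_le {φ φ' : ℝ → ℂ} (hφ : IntegrableOn φ (Set.Ioi 0))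
    (hφ' : IntegrableOn φ' (Set.Ioi 0)) (hderiv : ∀ ξ, HasDerivAt φ (φ' ξ) ξ) (h0 : φ 0 = 0)
    {Ω : ℂ} (hΩ : 0 ≤ Ω.im) :
    2 * Real.pi * ‖Ω‖ * ‖fourierLaplace φ Ω‖ ≤ ∫ ξ in Set.Ioi (0 : ℝ), ‖φ' ξ‖ := by
  have hparts := congrArg norm (two_pi_mul_fourierLaplace hφ hφ' hderiv h0 hΩ)
  simp only [norm_mul, norm_neg, Complex.norm_I, Complex.norm_real, Complex.norm_ofNat,
    Real.norm_of_nonneg Real.pi_pos.le, mul_one] at hparts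
  exact hparts.trans_le (norm_fourierLaplace_le hφ' hΩ)

lemma continuousOn_fourierLaplace_of_dominated {α : Type*} [TopologicalSpace α]
    [FirstCountableTopology α] {φ : α → ℝ → ℂ} {b : ℝ → ℝ}
    (hφ : ∀ x, AEStronglyMeasurable (φ x) (volume.restrict (Set.Ioi 0)))
    (hφb : ∀ x, ∀ ξ, 0 < ξ → ‖φ x ξ‖ ≤ b ξ) (hb : IntegrableOn b (Set.Ioi 0))
    (hcont : ∀ ξ, Continuous fun x => φ x ξ) :
    ContinuousOn (fun z : α × ℂ => fourierLaplace (φ z.1) z.2) {z | 0 ≤ z.2.im} := by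
  refine continuousOn_of_dominated (bound := b)
    (fun z _ => aestronglyMeasurable_exp_mul (hφ z.1) z.2) (fun z hz => ?_) hb
    (.of_forall fun ξ => ?_)
  · filter_upwards [ae_restrict_mem measurableSet_Ioi] with ξ hξ
    exact (norm_exp_two_pi_I_mul_mul_le _ hz (le_of_lt hξ)).trans (hφb z.1 ξ hξ)
  · exact Continuous.continuousOn (.mul (by fun_prop) ((hcont ξ).comp continuous_fst))

lemma differentiableOn_fourierLaplace {φ : ℝ → ℂ} (hφ : IntegrableOn φ (Set.Ioi 0))
    (hφ₁ : IntegrableOn (fun ξ => ξ * φ ξ) (Set.Ioi 0)) :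
    DifferentiableOn ℂ (fourierLaplace φ) {Ω | 0 < Ω.im} := by
  intro Ω₀ hΩ₀
  have hderiv (ξ : ℝ) (Ω : ℂ) :
      HasDerivAt (fun Ω : ℂ => Complex.exp (2 * Real.pi * Complex.I * Ω * ξ) * φ ξ)
        (Complex.exp (2 * Real.pi * Complex.I * Ω * ξ) *
          (2 * Real.pi * Complex.I * (ξ * φ ξ))) Ω := by
    have := (((hasDerivAt_id Ω).const_mul (2 * Real.pi * Complex.I : ℂ)).mul_const
      (ξ : ℂ)).cexp.mul_const (φ ξ)
    convert! this using 1
    simp only [id]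
    ring
  have hφ₁' := hφ₁.const_mul (2 * Real.pi * Complex.I)
  refine (hasDerivAt_integral_of_dominated_loc_of_deriv_le
    (UpperHalfPlane.isOpen_upperHalfPlaneSet.mem_nhds hΩ₀)
    (.of_forall fun Ω => aestronglyMeasurable_exp_mul hφ.1 Ω)
    (integrableOn_exp_mul hφ (le_of_lt hΩ₀)) (aestronglyMeasurable_exp_mul hφ₁'.1 Ω₀)
    ?_ hφ₁'.norm (.of_forall fun ξ Ω _ => hderiv ξ Ω)).2.differentiableAt.differentiableWithinAt
  filter_upwards [ae_restrict_mem measurableSet_Ioi] with ξ hξ Ω hΩ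
  exact norm_exp_two_pi_I_mul_mul_le _ (le_of_lt hΩ) (le_of_lt hξ)

lemma fourierLaplace_ofReal (φ : ℝ → ℂ) (x : ℝ) :
    fourierLaplace φ x = 𝓕 ((Set.Ioi 0).indicator φ) (-x) := by
  rw [Real.fourier_real_eq_integral_exp_smul, fourierLaplace,
    ← integral_indicator measurableSet_Ioi]
  congr 1 with ξ
  by_cases hξ : ξ ∈ Set.Ioi (0 : ℝ)
  · simp only [Set.indicator_of_mem hξ, smul_eq_mul]
    congr 2
    push_cast
    ring
  · simp [hξ]

lemma contDiff_fourierLaplace_ofReal {φ : ℝ → ℂ} (hφ : IntegrableOn φ (Set.Ioi 0))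
    (hφ₁ : IntegrableOn (fun ξ => ξ * φ ξ) (Set.Ioi 0)) :
    ContDiff ℝ 1 fun x : ℝ => fourierLaplace φ x := by
  have hF : ContDiff ℝ ((1 : ℕ∞) : WithTop ℕ∞) (𝓕 ((Set.Ioi (0 : ℝ)).indicator φ)) := by
    refine Real.contDiff_fourier fun n hn => ?_
    have hind : (fun ξ : ℝ => ‖ξ‖ ^ n * ‖(Set.Ioi (0 : ℝ)).indicator φ ξ‖) =
        (Set.Ioi 0).indicator fun ξ => ‖ξ‖ ^ n * ‖φ ξ‖ := by
      ext ξ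
      by_cases hξ : ξ ∈ Set.Ioi (0 : ℝ) <;> simp [hξ]
    rw [hind, integrable_indicator_iff measurableSet_Ioi]
    obtain rfl | rfl := Nat.le_one_iff_eq_zero_or_eq_one.1 (by exact_mod_cast hn)
    · simpa using! hφ.norm
    · simpa using! hφ₁.norm
  simp only [fourierLaplace_ofReal]
  exact hF.comp contDiff_neg

/-! ### Principal values and boundary values of the Cauchy integral -/

/-- The even part `(u(x-s) - u(x+s)) / s` of the integrand of the principal value at `x`. -/
def symmQuot (u : ℝ → ℝ) (x s : ℝ) : ℝ := (u (x - s) - u (x + s)) / s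

lemma measurable_symmQuot {u : ℝ → ℝ} (hu : Continuous u) (x : ℝ) :
    Measurable (symmQuot u x) :=
  Measurable.div (by fun_prop) measurable_id

lemma abs_symmQuot_le {u : ℝ → ℝ} {K : NNReal} (hK : LipschitzWith K u) (x : ℝ) {s : ℝ}
    (hs : 0 < s) : |symmQuot u x s| ≤ 2 * K := by
  have h := hK.dist_le_mul (x - s) (x + s)
  rw [Real.dist_eq, Real.dist_eq, show x - s - (x + s) = -(2 * s) by ring, abs_neg,
    abs_of_pos (mul_pos two_pos hs)] at h
  rw [symmQuot, abs_div, abs_of_pos hs, div_le_iff₀ hs]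
  linarith

lemma integrableOn_symmQuot {u : ℝ → ℝ} {K : NNReal} (hK : LipschitzWith K u) (hu : Integrable u)
    (x : ℝ) : IntegrableOn (symmQuot u x) (Set.Ioi 0) := by
  have hmeas := (measurable_symmQuot hK.continuous x).aestronglyMeasurable (μ := volume)
  rw [← Set.Ioc_union_Ioi_eq_Ioi (zero_le_one' ℝ)]
  refine IntegrableOn.union ?_ ?_
  · refine (integrableOn_const (C := 2 * (K : ℝ)) (by simp)).mono' hmeas.restrict ?_
    filter_upwards [ae_restrict_mem measurableSet_Ioc] with s hs
    exact abs_symmQuot_le hK x hs.1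
  · refine ((hu.comp_sub_left x).norm.add (hu.comp_add_left x).norm).integrableOn.mono'
      hmeas.restrict ?_
    filter_upwards [ae_restrict_mem measurableSet_Ioi] with s (hs : 1 < s)
    rw [symmQuot, norm_div, Real.norm_of_nonneg (by linarith : 0 ≤ s)]
    exact (div_le_self (norm_nonneg _) hs.le).trans (norm_sub_le _ _)

lemma integral_eq_integral_Ioi_add_neg {g : ℝ → ℝ} (hg : Integrable g) :
    ∫ s, g s = ∫ s in Set.Ioi (0 : ℝ), (g s + g (-s)) := by
  rw [integral_add hg.integrableOn hg.comp_neg.integrableOn, integral_comp_neg_Ioi, neg_zero,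
    add_comm, intervalIntegral.integral_Iic_add_Ioi hg.integrableOn hg.integrableOn]

lemma integral_mul_odd {u k : ℝ → ℝ} {x : ℝ} (hint : Integrable fun s => u (x - s) * k s)
    (hodd : k.Odd) :
    ∫ s, u (x - s) * k s = ∫ s in Set.Ioi (0 : ℝ), symmQuot u x s * (s * k s) := by
  rw [integral_eq_integral_Ioi_add_neg hint]
  refine setIntegral_congr_fun measurableSet_Ioi fun s hs => ?_
  have : s ≠ 0 := ne_of_gt hs
  simp only [symmQuot, hodd s, sub_neg_eq_add]
  field_simp
  ring

lemma tendsto_integral_mul_odd {u : ℝ → ℝ} {K : NNReal} (hK : LipschitzWith K u)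
    (hu : Integrable u) {k : ℝ → ℝ → ℝ} (hmeas : ∀ ε, Measurable (k ε)) (hodd : ∀ ε, (k ε).Odd)
    (hbdd : ∀ ε > 0, ∀ s, |k ε s| ≤ ε⁻¹) (hle : ∀ ε s, |s * k ε s| ≤ 1)
    (hlim : ∀ s > 0, Tendsto (fun ε => s * k ε s) (𝓝[>] 0) (𝓝 1)) (x : ℝ) :
    Tendsto (fun ε => ∫ s, u (x - s) * k ε s) (𝓝[>] 0)
      (𝓝 (∫ s in Set.Ioi (0 : ℝ), symmQuot u x s)) := by
  have hhalf : Tendsto (fun ε => ∫ s in Set.Ioi (0 : ℝ), symmQuot u x s * (s * k ε s)) (𝓝[>] 0)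
      (𝓝 (∫ s in Set.Ioi (0 : ℝ), symmQuot u x s)) := by
    refine tendsto_integral_filter_of_dominated_convergence (fun s => ‖symmQuot u x s‖)
      (.of_forall fun ε => ?_) (.of_forall fun ε => .of_forall fun s => ?_)
      (integrableOn_symmQuot hK hu x).norm ?_
    · exact ((measurable_symmQuot hK.continuous x).mul
        (measurable_id.mul (hmeas ε))).aestronglyMeasurable
    · rw [norm_mul]
      exact mul_le_of_le_one_right (norm_nonneg _) (hle ε s)
    · filter_upwards [ae_restrict_mem measurableSet_Ioi] with s hs
      simpa using (hlim s hs).const_mul (symmQuot u x s)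
  refine hhalf.congr' ?_
  filter_upwards [self_mem_nhdsWithin] with ε hε
  exact (integral_mul_odd ((hu.comp_sub_left x).mul_bdd (hmeas ε).aestronglyMeasurable
    (.of_forall (hbdd ε hε))) (hodd ε)).symm

lemma hilbertTrunc_eq_integral (u : ℝ → ℝ) (x ε : ℝ) :
    hilbertTrunc u x ε =
      Real.pi⁻¹ * ∫ s, u (x - s) * {s : ℝ | ε < |s|}.indicator (fun s => s⁻¹) s := by
  rw [hilbertTrunc, ← integral_indicator (measurableSet_lt measurable_const (by fun_prop)),
    ← integral_sub_left_eq_self _ _ x]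
  congr 2 with s
  by_cases hs : ε < |s| <;> simp [Set.indicator, hs, div_eq_mul_inv]

lemma tendsto_hilbertTrunc {u : ℝ → ℝ} {K : NNReal} (hK : LipschitzWith K u) (hu : Integrable u)
    (x : ℝ) :
    Tendsto (hilbertTrunc u x) (𝓝[>] 0)
      (𝓝 (Real.pi⁻¹ * ∫ s in Set.Ioi (0 : ℝ), symmQuot u x s)) := by
  simp only [funext (hilbertTrunc_eq_integral u x)]
  refine (tendsto_integral_mul_odd hK hu (fun ε => ?_) (fun ε s => ?_) (fun ε hε s => ?_)
    (fun ε s => ?_) (fun s hs => ?_) x).const_mul _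
  · exact measurable_inv.indicator (measurableSet_lt measurable_const measurable_id.norm)
  · by_cases h : ε < |s| <;> simp [Set.indicator, h, inv_neg]
  · by_cases h : ε < |s|
    · simpa [Set.indicator, h, abs_inv] using inv_anti₀ hε h.le
    · simpa [Set.indicator, h] using (le_of_lt hε)
  · by_cases h : ε < |s|
    · simpa [Set.indicator, h] using mul_inv_le_one_of_le₀ le_rfl (abs_nonneg s)
    · simp [Set.indicator, h]
  · refine tendsto_const_nhds.congr' ?_
    filter_upwards [mem_nhdsWithin_of_mem_nhds (Iio_mem_nhds (abs_pos.2 hs.ne'))] with ε hε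
    have hε' : ε < |s| := hε
    simp [Set.indicator, hε', hs.ne']

lemma hilbert_eq {u : ℝ → ℝ} {K : NNReal} (hK : LipschitzWith K u) (hu : Integrable u) (x : ℝ) :
    hilbert u x = Real.pi⁻¹ * ∫ s in Set.Ioi (0 : ℝ), symmQuot u x s :=
  (tendsto_hilbertTrunc hK hu x).limUnder_eq

lemma tendsto_hilbertTrunc_hilbert {u : ℝ → ℝ} {K : NNReal} (hK : LipschitzWith K u)
    (hu : Integrable u) (x : ℝ) :
    Tendsto (hilbertTrunc u x) (𝓝[>] 0) (𝓝 (hilbert u x)) :=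
  hilbert_eq hK hu x ▸ tendsto_hilbertTrunc hK hu x

lemma abs_mul_le_sq_add_sq (s ε : ℝ) : |s| * |ε| ≤ s ^ 2 + ε ^ 2 := by
  nlinarith [sq_abs s, sq_abs ε, sq_nonneg (|s| - |ε|)]

lemma abs_conjPoisson_le (s : ℝ) {ε : ℝ} (hε : 0 < ε) : |s / (s ^ 2 + ε ^ 2)| ≤ ε⁻¹ := by
  rw [abs_div, abs_of_nonneg (by positivity : 0 ≤ s ^ 2 + ε ^ 2),
    div_le_iff₀ (by positivity), ← div_eq_inv_mul, le_div_iff₀ hε]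
  simpa [abs_of_pos hε] using abs_mul_le_sq_add_sq s ε

lemma poisson_le (s : ℝ) {ε : ℝ} (hε : 0 < ε) : ε / (s ^ 2 + ε ^ 2) ≤ ε⁻¹ := by
  rw [div_le_iff₀ (by positivity), ← div_eq_inv_mul, le_div_iff₀ hε]
  nlinarith [sq_nonneg s]

lemma tendsto_conjPoisson {u : ℝ → ℝ} {K : NNReal} (hK : LipschitzWith K u) (hu : Integrable u)
    (x : ℝ) :
    Tendsto (fun ε : ℝ => ∫ s, u (x - s) * (s / (s ^ 2 + ε ^ 2))) (𝓝[>] 0)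
      (𝓝 (Real.pi * hilbert u x)) := by
  rw [hilbert_eq hK hu, mul_inv_cancel_left₀ Real.pi_ne_zero]
  refine tendsto_integral_mul_odd hK hu (k := fun ε s => s / (s ^ 2 + ε ^ 2)) (fun ε => ?_)
    (fun ε s => ?_) (fun ε hε s => abs_conjPoisson_le s hε) (fun ε s => ?_) (fun s hs => ?_) x
  · exact Measurable.div measurable_id (by fun_prop)
  · simp only [neg_sq, neg_div]
  · rw [← mul_div_assoc, abs_of_nonneg (div_nonneg (mul_self_nonneg s) (by positivity))]
    exact div_le_one_of_le₀ (by nlinarith [sq_nonneg ε]) (by positivity)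
  · have hcont : ContinuousAt (fun ε : ℝ => s * (s / (s ^ 2 + ε ^ 2))) 0 := by
      have : s ^ 2 + (0 : ℝ) ^ 2 ≠ 0 := by positivity
      fun_prop (disch := assumption)
    have hval : s * (s / (s ^ 2 + (0 : ℝ) ^ 2)) = 1 := by
      field_simp
      simp
    simpa only [hval] using hcont.tendsto.mono_left nhdsWithin_le_nhds

lemma tendsto_poisson {u : ℝ → ℝ} (hu : Integrable u) {x : ℝ} (hx : ContinuousAt u x) :
    Tendsto (fun ε : ℝ => ∫ s, u (x - s) * (ε / (s ^ 2 + ε ^ 2))) (𝓝[>] 0)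
      (𝓝 (Real.pi * u x)) := by
  have hmass : ∫ y : ℝ, Real.pi⁻¹ * (1 + y ^ 2)⁻¹ = 1 := by
    rw [integral_const_mul, integral_univ_inv_one_add_sq, inv_mul_cancel₀ Real.pi_ne_zero]
  have hdecay : Tendsto (fun y : ℝ => ‖y‖ ^ Module.finrank ℝ ℝ * (Real.pi⁻¹ * (1 + y ^ 2)⁻¹))
      (Bornology.cobounded ℝ) (𝓝 0) := by
    have hinv : Tendsto (fun y : ℝ => Real.pi⁻¹ * ‖y‖⁻¹) (Bornology.cobounded ℝ) (𝓝 0) := by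
      simpa using (tendsto_inv_atTop_zero.comp
        (tendsto_norm_cobounded_atTop (E := ℝ))).const_mul Real.pi⁻¹
    refine squeeze_zero (fun y => by positivity) (fun y => ?_) hinv
    obtain rfl | hy := eq_or_ne y 0
    · simp
    rw [Module.finrank_self, pow_one, mul_left_comm]
    gcongr
    rw [← div_eq_mul_inv, div_le_iff₀ (by positivity), Real.norm_eq_abs, inv_mul_eq_div,
      le_div_iff₀ (abs_pos.2 hy), abs_mul_abs_self]
    nlinarith
  have hpeak := (tendsto_integral_comp_smul_smul_of_integrable' (μ := volume)
    (fun y => by positivity) hmass hdecay hu hx).const_mul Real.pi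
  refine (hpeak.comp tendsto_inv_nhdsGT_zero).congr' ?_
  filter_upwards [self_mem_nhdsWithin] with ε (hε : 0 < ε)
  rw [Function.comp_apply, ← integral_const_mul, ← integral_sub_left_eq_self _ _ x]
  congr 1 with s
  have : Real.pi ≠ 0 := Real.pi_ne_zero
  have : s ^ 2 + ε ^ 2 ≠ 0 := by positivity
  have : 1 + (ε⁻¹ * s) ^ 2 ≠ 0 := by positivity
  simp only [Module.finrank_self, pow_one, smul_eq_mul, sub_sub_cancel]
  field_simp
  ring

lemma hilbertOff_add_mul_I {u : ℝ → ℝ} (hu : Integrable u) (x : ℝ) {ε : ℝ} (hε : 0 < ε) :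
    hilbertOff u (x + ε * Complex.I) =
      ((Real.pi⁻¹ * ∫ s, u (x - s) * (s / (s ^ 2 + ε ^ 2)) : ℝ) : ℂ) -
        Complex.I * ((Real.pi⁻¹ * ∫ s, u (x - s) * (ε / (s ^ 2 + ε ^ 2)) : ℝ) : ℂ) := by
  have hden (s : ℝ) : s ^ 2 + ε ^ 2 ≠ 0 := by positivity
  have hre : Integrable fun s => u (x - s) * (s / (s ^ 2 + ε ^ 2)) :=
    (hu.comp_sub_left x).mul_bdd
      (Measurable.div measurable_id (by fun_prop)).aestronglyMeasurable
      (.of_forall fun s => abs_conjPoisson_le s hε)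
  have him : Integrable fun s => u (x - s) * (ε / (s ^ 2 + ε ^ 2)) :=
    (hu.comp_sub_left x).mul_bdd
      (Continuous.aestronglyMeasurable (by fun_prop (disch := assumption)))
      (.of_forall fun s => by
        rw [Real.norm_of_nonneg (by positivity)]
        exact poisson_le s hε)
  have hker (s : ℝ) : (u (x - s) : ℂ) / (x + ε * Complex.I - ((x - s : ℝ) : ℂ)) =
      ((u (x - s) * (s / (s ^ 2 + ε ^ 2)) : ℝ) : ℂ) -
        Complex.I * ((u (x - s) * (ε / (s ^ 2 + ε ^ 2)) : ℝ) : ℂ) := by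
    have hden' : (s ^ 2 + ε ^ 2 : ℂ) ≠ 0 := by exact_mod_cast hden s
    have hfac : (s ^ 2 + ε ^ 2 : ℂ) = (s + ε * Complex.I) * (s - ε * Complex.I) := by
      linear_combination ((ε : ℂ) ^ 2) * Complex.I_sq
    have hne : (s + ε * Complex.I : ℂ) ≠ 0 := fun h => hden' (by rw [hfac, h, zero_mul])
    push_cast
    rw [show (x + ε * Complex.I - (x - s) : ℂ) = s + ε * Complex.I by ring, div_eq_iff hne]
    field_simp
    linear_combination (u (x - s) : ℂ) * hfac
  rw [hilbertOff, ← integral_sub_left_eq_self _ _ x, funext hker,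
    integral_sub hre.ofReal (him.ofReal.const_mul _), integral_const_mul, integral_complex_ofReal,
    integral_complex_ofReal]
  push_cast
  ring

lemma tendsto_hilbertOff_signal {u : ℝ → ℝ} {K : NNReal} (hK : LipschitzWith K u)
    (hu : Integrable u) (x : ℝ) :
    Tendsto (fun ε : ℝ => hilbertOff u (x + ε * Complex.I)) (𝓝[>] 0) (𝓝 (signal u x)) := by
  have hre := (tendsto_conjPoisson hK hu x).const_mul Real.pi⁻¹
  have him := (tendsto_poisson hu hK.continuous.continuousAt (x := x)).const_mul Real.pi⁻¹
  rw [inv_mul_cancel_left₀ Real.pi_ne_zero] at hre him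
  refine (hre.ofReal.sub (him.ofReal.const_mul Complex.I)).congr' ?_
  filter_upwards [self_mem_nhdsWithin] with ε hε
  exact (hilbertOff_add_mul_I hu x hε).symm

lemma hilbertOff_conj (u : ℝ → ℝ) (Ω : ℂ) : hilbertOff u (conj Ω) = conj (hilbertOff u Ω) := by
  simp only [hilbertOff, map_mul, map_inv₀, Complex.conj_ofReal]
  rw [← integral_conj]
  simp

/-- The holomorphic extension of the signal transform `S[u]` to the upper half-plane, written in
terms of the positive frequencies of `u`; it equals `H[u]` inside the half-plane. -/
def signalExt (u : ℝ → ℝ) (Ω : ℂ) : ℂ :=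
  -2 * Complex.I * fourierLaplace (𝓕 fun t => (u t : ℂ)) Ω

lemma two_pi_I_mul_re (Ω : ℂ) : (2 * Real.pi * Complex.I * Ω : ℂ).re = -(2 * Real.pi * Ω.im) := by
  simp [mul_assoc]

lemma two_pi_I_mul_re_neg {Ω : ℂ} (hΩ : 0 < Ω.im) :
    (2 * Real.pi * Complex.I * Ω : ℂ).re < 0 := by
  rw [two_pi_I_mul_re, neg_lt_zero]
  positivity

lemma integral_Ioi_exp_two_pi_I_mul {w : ℂ} (hw : 0 < w.im) :
    ∫ ξ in Set.Ioi (0 : ℝ), Complex.exp (2 * Real.pi * Complex.I * w * ξ) =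
      -(2 * Real.pi * Complex.I * w)⁻¹ := by
  rw [integral_exp_mul_complex_Ioi (two_pi_I_mul_re_neg hw)]
  simp [div_eq_mul_inv]

lemma integrable_mul_exp_prod {f : ℝ → ℂ} (hf : Integrable f) {Ω : ℂ} (hΩ : 0 < Ω.im) :
    Integrable (Function.uncurry fun t ξ : ℝ =>
      f t * Complex.exp (2 * Real.pi * Complex.I * (Ω - t) * ξ))
      (volume.prod (volume.restrict (Set.Ioi (0 : ℝ)))) := by
  have hprod := hf.mul_prod (integrableOn_exp_mul_complex_Ioi (two_pi_I_mul_re_neg hΩ) 0)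
  refine (hprod.mul_bdd (c := 1)
    (g := fun z : ℝ × ℝ => Complex.exp ((-2 * Real.pi * (z.1 * z.2) : ℝ) * Complex.I))
    (Continuous.aestronglyMeasurable (by fun_prop))
    (.of_forall fun z => (Complex.norm_exp_ofReal_mul_I _).le)).congr (.of_forall fun z => ?_)
  simp only [Function.uncurry, mul_assoc (f z.1), ← Complex.exp_add]
  congr 2
  push_cast
  ring

lemma hilbertOff_eq_signalExt {u : ℝ → ℝ} (hu : Integrable u) {Ω : ℂ} (hΩ : 0 < Ω.im) :
    hilbertOff u Ω = signalExt u Ω := by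
  have hcauchy (t : ℝ) : (u t : ℂ) / (Ω - t) = -(2 * Real.pi * Complex.I) *
      ∫ ξ in Set.Ioi (0 : ℝ), u t * Complex.exp (2 * Real.pi * Complex.I * (Ω - t) * ξ) := by
    have him : 0 < (Ω - t).im := by simpa using hΩ
    have : Ω - t ≠ 0 := fun h => him.ne' (by rw [h, Complex.zero_im])
    rw [integral_const_mul, integral_Ioi_exp_two_pi_I_mul him]
    have := Complex.two_pi_I_ne_zero
    field_simp
  have hfourier (ξ : ℝ) :
      ∫ t : ℝ, (u t : ℂ) * Complex.exp (2 * Real.pi * Complex.I * (Ω - t) * ξ) =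
        Complex.exp (2 * Real.pi * Complex.I * Ω * ξ) * 𝓕 (fun t => (u t : ℂ)) ξ := by
    rw [Real.fourier_real_eq_integral_exp_smul, ← integral_const_mul]
    congr 1 with t
    rw [smul_eq_mul, ← mul_assoc, ← Complex.exp_add, mul_comm]
    congr 2
    push_cast
    ring
  rw [hilbertOff, signalExt, fourierLaplace, funext hcauchy, integral_const_mul,
    integral_integral_swap (integrable_mul_exp_prod (f := fun t => (u t : ℂ)) hu.ofReal hΩ),
    funext hfourier, ← mul_assoc]
  congr 1
  field_simp

section IntegrableFourier

variable {u : ℝ → ℝ} (hFu : IntegrableOn (𝓕 fun t => (u t : ℂ)) (Set.Ioi 0))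
include hFu

lemma continuousOn_signalExt : ContinuousOn (signalExt u) {Ω | 0 ≤ Ω.im} :=
  continuousOn_const.mul <| (continuousOn_fourierLaplace_of_dominated (α := Unit)
    (fun _ => hFu.1) (fun _ _ _ => le_rfl) hFu.norm fun _ => continuous_const).comp
    (f := fun Ω : ℂ => ((), Ω)) (by fun_prop) fun _ h => h

lemma signal_eq_signalExt {K : NNReal} (hK : LipschitzWith K u) (hu : Integrable u) (x : ℝ) :
    signal u x = signalExt u x := by
  have hvert : Tendsto (fun ε : ℝ => (x + ε * Complex.I : ℂ)) (𝓝[>] 0)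
      (𝓝[{Ω | 0 ≤ Ω.im}] x) := by
    refine tendsto_nhdsWithin_iff.2 ⟨?_, ?_⟩
    · have : Continuous fun ε : ℝ => (x + ε * Complex.I : ℂ) := by fun_prop
      simpa using (this.tendsto 0).mono_left nhdsWithin_le_nhds
    · filter_upwards [self_mem_nhdsWithin] with ε (hε : 0 < ε)
      simpa using hε.le
  have hcont := continuousOn_signalExt hFu (x : ℂ) (by simp)
  refine tendsto_nhds_unique (tendsto_hilbertOff_signal hK hu x)
    ((hcont.tendsto.comp hvert).congr' ?_)
  filter_upwards [self_mem_nhdsWithin] with ε hε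
  exact (hilbertOff_eq_signalExt hu (by simpa using hε)).symm

end IntegrableFourier

/-! ### Divided differences of a Schwartz function -/

/-- The multiplier `sin (πXξ) / (πX)`, equal to `ξ` at `X = 0`, through which `D_X` acts on the
Fourier side. -/
def sineSymbol (X ξ : ℝ) : ℝ := ξ * Real.sinc (Real.pi * X * ξ)

lemma continuous_sineSymbol : Continuous fun z : ℝ × ℝ => sineSymbol z.1 z.2 := by
  unfold sineSymbol
  have := Real.continuous_sinc
  fun_prop

lemma abs_sineSymbol_le (X ξ : ℝ) : |sineSymbol X ξ| ≤ |ξ| := by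
  rw [sineSymbol, abs_mul]
  exact mul_le_of_le_one_right (abs_nonneg _) (Real.abs_sinc_le_one _)

lemma mul_sineSymbol (X ξ : ℝ) : Real.pi * X * sineSymbol X ξ = Real.sin (Real.pi * X * ξ) := by
  obtain h | h := eq_or_ne (Real.pi * X * ξ) 0
  · rw [sineSymbol, ← mul_assoc, h, zero_mul, Real.sin_zero]
  · rw [sineSymbol, ← mul_assoc, Real.sinc_of_ne_zero h, mul_div_cancel₀ _ h]

lemma abs_mul_abs_sineSymbol_le (X ξ : ℝ) : Real.pi * |X| * |sineSymbol X ξ| ≤ 1 := by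
  have h := Real.abs_sin_le_one (Real.pi * X * ξ)
  rwa [← mul_sineSymbol, abs_mul, abs_mul, abs_of_pos Real.pi_pos] at h

lemma hasDerivAt_sineSymbol (X ξ : ℝ) :
    HasDerivAt (sineSymbol X) (Real.cos (Real.pi * X * ξ)) ξ := by
  obtain rfl | hX := eq_or_ne X 0
  · have hsym : sineSymbol 0 = id := by
      ext ξ
      simp [sineSymbol]
    simpa [hsym] using hasDerivAt_id ξ
  · have hsym : sineSymbol X = fun ξ => Real.sin (Real.pi * X * ξ) / (Real.pi * X) := by
      ext ξ
      rw [← mul_sineSymbol, mul_div_cancel_left₀ _ (mul_ne_zero Real.pi_ne_zero hX)]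
    have := (((hasDerivAt_id ξ).const_mul (Real.pi * X)).sin).div_const (Real.pi * X)
    rw [hsym]
    convert! this using 1
    simp only [id]
    field_simp

/-- The Schwartz function `D_X P`. -/
def schwartzDivDiff (P : 𝓢(ℝ, ℝ)) (X : ℝ) : 𝓢(ℝ, ℝ) :=
  if X = 0 then SchwartzMap.derivCLM ℝ ℝ P
  else X⁻¹ • (P.compSubConstCLM ℝ (-(X / 2)) - P.compSubConstCLM ℝ (X / 2))

lemma coe_schwartzDivDiff (P : 𝓢(ℝ, ℝ)) (X : ℝ) : ⇑(schwartzDivDiff P X) = divDiff P X := by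
  ext k
  by_cases hX : X = 0
  · simp [schwartzDivDiff, divDiff, hX]
  · simp [schwartzDivDiff, divDiff, hX, div_eq_inv_mul]

lemma integrable_divDiff (P : 𝓢(ℝ, ℝ)) (X : ℝ) : Integrable (divDiff P X) :=
  coe_schwartzDivDiff P X ▸ (schwartzDivDiff P X).integrable

lemma exists_lipschitzWith_schwartzMap (f : 𝓢(ℝ, ℝ)) : ∃ K, LipschitzWith K f :=
  ⟨⟨_, apply_nonneg (SchwartzMap.seminorm ℝ 0 0) (SchwartzMap.derivCLM ℝ ℝ f)⟩,
    lipschitzWith_of_nnnorm_deriv_le f.differentiable fun x => by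
      simpa using! (SchwartzMap.derivCLM ℝ ℝ f).norm_le_seminorm ℝ x⟩

lemma exists_lipschitzWith_divDiff (P : 𝓢(ℝ, ℝ)) (X : ℝ) : ∃ K, LipschitzWith K (divDiff P X) :=
  coe_schwartzDivDiff P X ▸ exists_lipschitzWith_schwartzMap (schwartzDivDiff P X)

/-- A real Schwartz function, regarded as a complex-valued one. -/
def complexify (P : 𝓢(ℝ, ℝ)) : 𝓢(ℝ, ℂ) :=
  SchwartzMap.postcompCLM (𝕜 := ℝ) Complex.ofRealCLM P

@[simp]
lemma complexify_apply (P : 𝓢(ℝ, ℝ)) (k : ℝ) : complexify P k = P k := rfl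

lemma fourier_comp_sub (f : ℝ → ℂ) (a ξ : ℝ) :
    𝓕 (fun t => f (t - a)) ξ = Complex.exp (-(2 * Real.pi * a * ξ * Complex.I)) * 𝓕 f ξ := by
  have h := congrFun (Fourier.fourierIntegral_comp_add_right Real.fourierChar volume f (-a)) ξ
  simp only [Circle.smul_def, Real.fourierChar_apply, smul_eq_mul] at h
  simp only [Real.fourier_real_eq, Function.comp_def, Fourier.fourierIntegral_def,
    ← sub_eq_add_neg] at h ⊢
  rw [h]
  congr 2
  push_cast
  ring

lemma fourier_deriv_complexify (P : 𝓢(ℝ, ℝ)) (ξ : ℝ) :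
    𝓕 (fun k => ((deriv P k : ℝ) : ℂ)) ξ = 2 * Real.pi * Complex.I * (ξ * 𝓕 (complexify P) ξ) := by
  have hderiv : (fun k => ((deriv P k : ℝ) : ℂ)) = deriv (complexify P) := by
    ext k
    exact (P.differentiableAt.hasDerivAt.ofReal_comp.deriv).symm
  have hint := (SchwartzMap.derivCLM ℂ ℂ (complexify P)).integrable (μ := volume)
  rw [hderiv, Real.fourier_deriv (complexify P).integrable (complexify P).differentiable hint,
    SchwartzMap.fourier_coe]
  simp only [smul_eq_mul, mul_assoc]

lemma fourier_divDiff (P : 𝓢(ℝ, ℝ)) (X ξ : ℝ) :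
    𝓕 (fun k => (divDiff P X k : ℂ)) ξ =
      2 * Real.pi * Complex.I * (sineSymbol X ξ * 𝓕 (complexify P) ξ) := by
  obtain rfl | hX := eq_or_ne X 0
  · simpa [divDiff, sineSymbol] using fourier_deriv_complexify P ξ
  · set f := complexify P
    have hdiff : (fun k => (divDiff P X k : ℂ)) =
        ⇑((X⁻¹ : ℂ) • (f.compSubConstCLM ℂ (-(X / 2)) + -f.compSubConstCLM ℂ (X / 2))) := by
      ext k
      simp [divDiff, hX, f, div_eq_inv_mul]
      ring
    have htranslate (a : ℝ) : 𝓕 (f.compSubConstCLM ℂ a) ξ =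
        Complex.exp (-(2 * Real.pi * a * ξ * Complex.I)) * 𝓕 f ξ := fourier_comp_sub f a ξ
    have hsin : (Real.pi * X * sineSymbol X ξ : ℂ) = Complex.sin (Real.pi * X * ξ) := by
      exact_mod_cast mul_sineSymbol X ξ
    have hX' : (X : ℂ) ≠ 0 := by exact_mod_cast hX
    rw [hdiff, ← SchwartzMap.fourier_coe, FourierTransform.fourier_smul,
      FourierTransform.fourier_add, FourierTransform.fourier_neg]
    simp only [smul_apply, add_apply, neg_apply, htranslate, smul_eq_mul]
    rw [inv_mul_eq_iff_eq_mul₀ hX']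
    have hfreq : (2 * Real.pi * (X / 2 : ℝ) * ξ : ℂ) = Real.pi * X * ξ := by
      push_cast
      ring
    calc _ = (Complex.exp (Real.pi * X * ξ * Complex.I) -
          Complex.exp (-(Real.pi * X * ξ) * Complex.I)) * 𝓕 f ξ := by
          rw [← hfreq]
          push_cast
          ring_nf
      _ = 2 * Complex.I * Complex.sin (Real.pi * X * ξ) * 𝓕 f ξ := by
          rw [Complex.sin]
          linear_combination (Complex.exp (-(Real.pi * X * ξ) * Complex.I) -
            Complex.exp (Real.pi * X * ξ * Complex.I)) * 𝓕 f ξ * -Complex.I_sq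
      _ = _ := by
          rw [← hsin]
          ring

lemma divDiff_neg (P : ℝ → ℝ) (X : ℝ) : divDiff P (-X) = divDiff P X := by
  ext k
  by_cases hX : X = 0
  · simp [hX]
  · simp only [divDiff, hX, neg_eq_zero, if_false]
    rw [← neg_div_neg_eq]
    congr 1 <;> ring_nf

/-- The symbol `sin (πXξ) / (πX) · Q(ξ)`. For `Q = 𝓕 P` it is, up to the factor `2πi`, the Fourier
transform of `D_X P`. -/
def divDiffSymbol (Q : 𝓢(ℝ, ℂ)) (X ξ : ℝ) : ℂ := sineSymbol X ξ * Q ξ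

lemma continuous_divDiffSymbol (Q : 𝓢(ℝ, ℂ)) :
    Continuous fun z : ℝ × ℝ => divDiffSymbol Q z.1 z.2 :=
  (Complex.continuous_ofReal.comp continuous_sineSymbol).mul (Q.continuous.comp continuous_snd)

lemma norm_divDiffSymbol_le (Q : 𝓢(ℝ, ℂ)) (X ξ : ℝ) : ‖divDiffSymbol Q X ξ‖ ≤ ‖ξ‖ * ‖Q ξ‖ := by
  rw [divDiffSymbol, norm_mul, Complex.norm_real]
  gcongr
  exact abs_sineSymbol_le X ξ

lemma integrable_pow_mul_divDiffSymbol (Q : 𝓢(ℝ, ℂ)) (X : ℝ) (n : ℕ) :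
    Integrable fun ξ : ℝ => (ξ : ℂ) ^ n * divDiffSymbol Q X ξ := by
  refine (Q.integrable_pow_mul volume (n + 1)).mono' (Continuous.aestronglyMeasurable ?_)
    (.of_forall fun ξ => ?_)
  · have := continuous_divDiffSymbol Q
    fun_prop
  · rw [norm_mul, norm_pow, Complex.norm_real, pow_succ, mul_assoc]
    gcongr
    exact norm_divDiffSymbol_le Q X ξ

lemma integrable_divDiffSymbol (Q : 𝓢(ℝ, ℂ)) (X : ℝ) : Integrable (divDiffSymbol Q X) := by
  simpa using integrable_pow_mul_divDiffSymbol Q X 0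

lemma hasDerivAt_divDiffSymbol (Q : 𝓢(ℝ, ℂ)) (X ξ : ℝ) :
    HasDerivAt (divDiffSymbol Q X)
      (Real.cos (Real.pi * X * ξ) * Q ξ + sineSymbol X ξ * deriv Q ξ) ξ :=
  (hasDerivAt_sineSymbol X ξ).ofReal_comp.mul Q.differentiableAt.hasDerivAt

lemma norm_deriv_divDiffSymbol_le (Q : 𝓢(ℝ, ℂ)) (X ξ : ℝ) :
    ‖Real.cos (Real.pi * X * ξ) * Q ξ + sineSymbol X ξ * deriv Q ξ‖ ≤
      ‖Q ξ‖ + ‖ξ‖ * ‖deriv Q ξ‖ := by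
  refine (norm_add_le _ _).trans ?_
  rw [norm_mul, norm_mul, Complex.norm_real, Complex.norm_real]
  gcongr
  · exact mul_le_of_le_one_left (norm_nonneg _) (Real.abs_cos_le_one _)
  · exact abs_sineSymbol_le X ξ

lemma integrable_norm_add_norm_mul_norm_deriv (Q : 𝓢(ℝ, ℂ)) :
    Integrable fun ξ => ‖Q ξ‖ + ‖ξ‖ * ‖deriv Q ξ‖ := by
  have hQ' := (SchwartzMap.derivCLM ℝ ℂ Q).integrable_pow_mul volume 1
  exact Q.integrable.norm.add (by simpa using hQ')

lemma norm_mul_norm_fourierLaplace_divDiffSymbol_le (Q : 𝓢(ℝ, ℂ)) (X : ℝ) {Ω : ℂ}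
    (hΩ : 0 ≤ Ω.im) :
    2 * Real.pi * ‖Ω‖ * ‖fourierLaplace (divDiffSymbol Q X) Ω‖ ≤
      ∫ ξ in Set.Ioi (0 : ℝ), ‖Q ξ‖ + ‖ξ‖ * ‖deriv Q ξ‖ := by
  have hbound := integrable_norm_add_norm_mul_norm_deriv Q
  have hderiv : Integrable fun ξ : ℝ =>
      (Real.cos (Real.pi * X * ξ) * Q ξ + sineSymbol X ξ * deriv Q ξ : ℂ) := by
    refine hbound.mono' (Continuous.aestronglyMeasurable ?_)
      (.of_forall (norm_deriv_divDiffSymbol_le Q X))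
    have hs : Continuous (sineSymbol X) := continuous_sineSymbol.comp (.prodMk_right X)
    have hQ' : Continuous (deriv Q) := (SchwartzMap.derivCLM ℝ ℂ Q).continuous
    have hQ := Q.continuous
    fun_prop
  exact (norm_mul_norm_fourierLaplace_le (integrable_divDiffSymbol Q X).integrableOn
    hderiv.integrableOn (hasDerivAt_divDiffSymbol Q X) (by simp [divDiffSymbol, sineSymbol])
    hΩ).trans (integral_mono hderiv.norm.integrableOn hbound.integrableOn
      (norm_deriv_divDiffSymbol_le Q X))

lemma abs_mul_norm_fourierLaplace_divDiffSymbol_le (Q : 𝓢(ℝ, ℂ)) (X : ℝ) {Ω : ℂ}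
    (hΩ : 0 ≤ Ω.im) :
    Real.pi * |X| * ‖fourierLaplace (divDiffSymbol Q X) Ω‖ ≤ ∫ ξ in Set.Ioi (0 : ℝ), ‖Q ξ‖ := by
  refine (mul_le_mul_of_nonneg_left (norm_fourierLaplace_le
    (integrable_divDiffSymbol Q X).integrableOn hΩ) (by positivity)).trans ?_
  rw [← integral_const_mul]
  refine integral_mono ((integrable_divDiffSymbol Q X).norm.const_mul _).integrableOn
    Q.integrable.norm.integrableOn fun ξ => ?_
  simp only [divDiffSymbol, norm_mul, Complex.norm_real, Real.norm_eq_abs, ← mul_assoc]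
  exact mul_le_of_le_one_left (norm_nonneg _) (abs_mul_abs_sineSymbol_le X ξ)

section SignalExt

variable (P : 𝓢(ℝ, ℝ))

lemma fourier_divDiff_eq_symbol (X : ℝ) : (𝓕 fun k => (divDiff P X k : ℂ)) =
    fun ξ => 2 * Real.pi * Complex.I * divDiffSymbol (𝓕 (complexify P)) X ξ :=
  funext (fourier_divDiff P X)

lemma integrable_fourier_divDiff (X : ℝ) : Integrable (𝓕 fun k => (divDiff P X k : ℂ)) := by
  rw [fourier_divDiff_eq_symbol]
  exact (integrable_divDiffSymbol _ X).const_mul _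

lemma signalExt_divDiff (X : ℝ) (Ω : ℂ) : signalExt (divDiff P X) Ω =
    4 * Real.pi * fourierLaplace (divDiffSymbol (𝓕 (complexify P)) X) Ω := by
  simp only [signalExt, fourierLaplace, fourier_divDiff_eq_symbol, mul_left_comm (Complex.exp _)]
  rw [integral_const_mul]
  linear_combination (-4 * Real.pi * ∫ ξ in Set.Ioi (0 : ℝ),
    Complex.exp (2 * Real.pi * Complex.I * Ω * ξ) * divDiffSymbol (𝓕 (complexify P)) X ξ) *
      Complex.I_sq

lemma continuousOn_signalExt_divDiff :
    ContinuousOn (fun z : ℝ × ℂ => signalExt (divDiff P z.1) z.2) {z | 0 ≤ z.2.im} := by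
  simp only [signalExt_divDiff]
  have hcont := continuous_divDiffSymbol (𝓕 (complexify P))
  have hbound := (𝓕 (complexify P)).integrable_pow_mul volume 1
  refine continuousOn_const.mul (continuousOn_fourierLaplace_of_dominated
    (fun X => (integrable_divDiffSymbol _ X).aestronglyMeasurable.restrict)
    (fun X ξ _ => norm_divDiffSymbol_le _ X ξ) (by simpa using hbound.integrableOn)
    fun ξ => hcont.comp (.prodMk_left ξ))

lemma exists_norm_mul_norm_signalExt_divDiff_le :
    ∃ C, ∀ z : ℝ × ℂ, 0 ≤ z.2.im → ‖z‖ * ‖signalExt (divDiff P z.1) z.2‖ ≤ C := by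
  set Q := 𝓕 (complexify P)
  refine ⟨max (4 * ∫ ξ in Set.Ioi (0 : ℝ), ‖Q ξ‖)
    (2 * ∫ ξ in Set.Ioi (0 : ℝ), ‖Q ξ‖ + ‖ξ‖ * ‖deriv Q ξ‖), fun z hz => ?_⟩
  have hX := abs_mul_norm_fourierLaplace_divDiffSymbol_le Q z.1 hz
  have hΩ := norm_mul_norm_fourierLaplace_divDiffSymbol_le Q z.1 hz
  have hnorm : ‖signalExt (divDiff P z.1) z.2‖ =
      4 * Real.pi * ‖fourierLaplace (divDiffSymbol Q z.1) z.2‖ := by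
    simp [signalExt_divDiff, Q, abs_of_pos Real.pi_pos]
  rw [hnorm, Prod.norm_def, max_mul_of_nonneg _ _ (by positivity)]
  refine max_le_max ?_ ?_
  · rw [Real.norm_eq_abs]
    linarith
  · linarith

lemma differentiableOn_signalExt_divDiff (X : ℝ) :
    DifferentiableOn ℂ (signalExt (divDiff P X)) {Ω | 0 < Ω.im} := by
  have h₁ := integrable_pow_mul_divDiffSymbol (𝓕 (complexify P)) X 1
  rw [funext (signalExt_divDiff P X)]
  exact (differentiableOn_fourierLaplace (integrable_divDiffSymbol _ X).integrableOn
    (by simpa using h₁.integrableOn)).const_mul _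

lemma contDiff_signalExt_divDiff_ofReal (X : ℝ) :
    ContDiff ℝ 1 fun x : ℝ => signalExt (divDiff P X) x := by
  have h₁ := integrable_pow_mul_divDiffSymbol (𝓕 (complexify P)) X 1
  simp only [signalExt_divDiff]
  exact contDiff_const.mul (contDiff_fourierLaplace_ofReal
    (integrable_divDiffSymbol _ X).integrableOn (by simpa using h₁.integrableOn))

lemma tendsto_hilbertTrunc_hilbert_divDiff (X t : ℝ) :
    Tendsto (hilbertTrunc (divDiff P X) t) (𝓝[>] 0) (𝓝 (hilbert (divDiff P X) t)) :=
  have ⟨_, hK⟩ := exists_lipschitzWith_divDiff P X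
  tendsto_hilbertTrunc_hilbert hK (integrable_divDiff P X) t

lemma signal_divDiff (X x : ℝ) : signal (divDiff P X) x = signalExt (divDiff P X) x :=
  have ⟨_, hK⟩ := exists_lipschitzWith_divDiff P X
  signal_eq_signalExt (integrable_fourier_divDiff P X).integrableOn hK (integrable_divDiff P X) x

end SignalExt

/-! ### The stability condition -/

section KernelLaplace

open scoped Pointwise

lemma kernel_eq_divDiffSymbol (P : 𝓢(ℝ, ℝ)) (p q X t : ℝ) :
    kernel P p q X t = -(2 * Real.pi * q * X) *
      divDiffSymbol (𝓕 (complexify P)) X (-(2 * Real.pi * p * X) * t) := by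
  have hsin : Real.sin (2 * Real.pi ^ 2 * p * X ^ 2 * t) =
      -(Real.pi * X * sineSymbol X (-(2 * Real.pi * p * X) * t)) := by
    rw [mul_sineSymbol, ← Real.sin_neg]
    congr 1
    ring
  have hfourier : (𝓕⁻ fun k : ℝ => (P k : ℂ)) (2 * Real.pi * p * X * t) =
      𝓕 (complexify P) (-(2 * Real.pi * p * X) * t) := by
    rw [Real.fourierInv_eq_fourier_neg, neg_mul, SchwartzMap.fourier_coe]
    rfl
  rw [kernel, hsin, hfourier, divDiffSymbol]
  push_cast
  ring

/-- The point `Ω` of the upper or lower half-plane that corresponds to the Laplace variable `ω`. -/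
def laplacePoint (p X : ℝ) (ω : ℂ) : ℂ :=
  -Complex.I * ω / (4 * Real.pi ^ 2 * p * X : ℝ)

lemma im_laplacePoint (p X : ℝ) (ω : ℂ) :
    (laplacePoint p X ω).im = -ω.re / (4 * Real.pi ^ 2 * p * X) := by
  rw [laplacePoint, Complex.div_ofReal_im]
  simp

lemma conj_laplacePoint_conj (p X : ℝ) (ω : ℂ) :
    conj (laplacePoint p X (conj ω)) = laplacePoint p (-X) ω := by
  simp only [laplacePoint, map_div₀, map_mul, map_neg, Complex.conj_I, Complex.conj_conj,
    Complex.conj_ofReal, mul_neg, Complex.ofReal_neg, neg_neg, neg_mul, neg_div_neg_eq]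

lemma kernelLaplace_of_mul_neg (P : 𝓢(ℝ, ℝ)) {p : ℝ} (q : ℝ) {X : ℝ} (hpX : p * X < 0) {ω : ℂ}
    (hω : 0 < ω.re) : kernelLaplace P p q X ω =
      (q / (4 * Real.pi * p) : ℝ) * hilbertOff (divDiff P X) (laplacePoint p X ω) := by
  have hp : (p : ℂ) ≠ 0 := Complex.ofReal_ne_zero.2 (left_ne_zero_of_mul hpX.ne)
  have hX : (X : ℂ) ≠ 0 := Complex.ofReal_ne_zero.2 (right_ne_zero_of_mul hpX.ne)
  have hpi : (Real.pi : ℂ) ≠ 0 := Complex.ofReal_ne_zero.2 Real.pi_ne_zero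
  have hscale : 0 < -(2 * Real.pi * p * X) := by nlinarith [Real.pi_pos]
  have hΩ : 0 < (laplacePoint p X ω).im := by
    rw [im_laplacePoint]
    exact div_pos_of_neg_of_neg (neg_neg_of_pos hω) (by nlinarith [sq_pos_of_pos Real.pi_pos])
  set g : ℝ → ℂ := fun ξ => Complex.exp (2 * Real.pi * Complex.I * laplacePoint p X ω * ξ) *
    divDiffSymbol (𝓕 (complexify P)) X ξ
  have hg (t : ℝ) : Complex.exp (-ω * t) * kernel P p q X t =
      -(2 * Real.pi * q * X) * g (-(2 * Real.pi * p * X) * t) := by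
    have hexp : 2 * Real.pi * Complex.I * laplacePoint p X ω * (-(2 * Real.pi * p * X) * t : ℝ) =
        -ω * t := by
      rw [laplacePoint]
      push_cast
      field_simp
      linear_combination 4 * ω * t * Complex.I_sq
    simp only [g]
    rw [kernel_eq_divDiffSymbol, hexp]
    ring
  rw [kernelLaplace, funext hg, integral_const_mul, integral_comp_mul_left_Ioi g 0 hscale, mul_zero,
    hilbertOff_eq_signalExt (integrable_divDiff P X) hΩ, signalExt_divDiff, Complex.real_smul]
  change _ * (_ * fourierLaplace _ _) = _
  push_cast
  field_simp

lemma kernel_neg (P : ℝ → ℝ) (p q X t : ℝ) : kernel P p q (-X) t = conj (kernel P p q X t) := by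
  have hfourier : (𝓕⁻ fun k : ℝ => (P k : ℂ)) (2 * Real.pi * p * -X * t) =
      conj ((𝓕⁻ fun k : ℝ => (P k : ℂ)) (2 * Real.pi * p * X * t)) := by
    rw [Real.fourierInv_eq', Real.fourierInv_eq', ← integral_conj]
    congr 1 with k
    simp only [smul_eq_mul, map_mul, ← Complex.exp_conj, Complex.conj_ofReal, Complex.conj_I]
    congr 2
    simp
  simp only [kernel, hfourier, map_mul, Complex.conj_ofReal, neg_sq, map_ofNat]

lemma kernelLaplace_neg (P : ℝ → ℝ) (p q X : ℝ) (ω : ℂ) :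
    kernelLaplace P p q (-X) ω = conj (kernelLaplace P p q X (conj ω)) := by
  rw [kernelLaplace, kernelLaplace, ← integral_conj]
  congr 1 with t
  rw [kernel_neg, map_mul, ← Complex.exp_conj]
  simp

lemma kernelLaplace_eq_hilbertOff (P : 𝓢(ℝ, ℝ)) {p : ℝ} (hp : p ≠ 0) (q : ℝ) {X : ℝ} (hX : X ≠ 0)
    {ω : ℂ} (hω : 0 < ω.re) : kernelLaplace P p q X ω =
      (q / (4 * Real.pi * p) : ℝ) * hilbertOff (divDiff P X) (laplacePoint p X ω) := by
  obtain h | h := lt_or_gt_of_ne (mul_ne_zero hp hX)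
  · exact kernelLaplace_of_mul_neg P q h hω
  · have hneg := kernelLaplace_neg P p q (-X) ω
    rw [neg_neg, kernelLaplace_of_mul_neg P q (X := -X) (by linarith) (by simpa using hω),
      divDiff_neg] at hneg
    rw [hneg, map_mul, Complex.conj_ofReal, ← hilbertOff_conj, conj_laplacePoint_conj, neg_neg]

lemma exists_laplacePoint_eq {p X : ℝ} {Ω : ℂ} (h : p * X * Ω.im < 0) :
    ∃ ω : ℂ, 0 < ω.re ∧ laplacePoint p X ω = Ω := by
  have hpX : p * X ≠ 0 := left_ne_zero_of_mul h.ne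
  have hscale : ((4 * Real.pi ^ 2 * p * X : ℝ) : ℂ) ≠ 0 := by
    rw [Complex.ofReal_ne_zero, mul_assoc]
    have := Real.pi_ne_zero
    positivity
  refine ⟨Complex.I * ((4 * Real.pi ^ 2 * p * X : ℝ) * Ω), ?_, ?_⟩
  · rw [Complex.I_mul_re, Complex.im_ofReal_mul]
    nlinarith [sq_pos_of_pos Real.pi_pos]
  · rw [laplacePoint, div_eq_iff hscale]
    linear_combination (-(4 * Real.pi ^ 2 * p * X : ℝ) * Ω) * Complex.I_sq

lemma range_kernelLaplace (P : 𝓢(ℝ, ℝ)) {p : ℝ} (hp : p ≠ 0) (q : ℝ) :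
    (Set.range fun z : ℝ × {ω : ℂ // 0 < ω.re} => kernelLaplace P p q z.1 z.2) =
      insert 0 (((q / (4 * Real.pi * p) : ℝ) : ℂ) •
        (fun z : ℝ × ℂ => hilbertOff (divDiff P z.1) z.2) '' {z | z.1 ≠ 0 ∧ z.2.im ≠ 0}) := by
  refine Set.Subset.antisymm ?_ (Set.insert_subset ⟨(0, ⟨1, by simp⟩), ?_⟩ ?_)
  · rintro _ ⟨⟨X, ω, hω⟩, rfl⟩
    obtain rfl | hX := eq_or_ne X 0
    · exact .inl (by simp [kernelLaplace, kernel])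
    · have hΩ : (laplacePoint p X ω).im ≠ 0 := by
        rw [im_laplacePoint]
        have := Real.pi_ne_zero
        exact div_ne_zero (neg_ne_zero.2 hω.ne') (by positivity)
      exact .inr ⟨_, ⟨(X, laplacePoint p X ω), ⟨hX, hΩ⟩, rfl⟩,
        (kernelLaplace_eq_hilbertOff P hp q hX hω).symm⟩
  · simp [kernelLaplace, kernel]
  · rintro _ ⟨_, ⟨⟨X, Ω⟩, ⟨hX, hΩ⟩, rfl⟩, rfl⟩
    obtain ⟨Y, hY, hpY, hYX⟩ : ∃ Y : ℝ, Y ≠ 0 ∧ p * Y * Ω.im < 0 ∧ divDiff P Y = divDiff P X := by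
      obtain h | h := lt_or_gt_of_ne (mul_ne_zero (mul_ne_zero hp hX) hΩ)
      · exact ⟨X, hX, h, rfl⟩
      · exact ⟨-X, neg_ne_zero.2 hX, by linarith, divDiff_neg P X⟩
    obtain ⟨ω, hω, rfl⟩ := exists_laplacePoint_eq hpY
    exact ⟨(Y, ⟨ω, hω⟩), (kernelLaplace_eq_hilbertOff P hp q hY hω).trans (by rw [hYX]; rfl)⟩

lemma not_isStable_iff (P : ℝ → ℝ) (p q : ℝ) : ¬ IsStable P p q ↔ penroseInf P p q = 0 := by
  have h0 : 0 ≤ penroseInf P p q := Real.iInf_nonneg fun _ => norm_nonneg _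
  refine ⟨fun h => ?_, fun h ⟨κ, hκ, hle⟩ => by linarith⟩
  by_contra hne
  exact h ⟨_, h0.lt_of_ne' hne, le_rfl⟩

lemma penroseInf_eq_infDist (P : ℝ → ℝ) (p q : ℝ) : penroseInf P p q = Metric.infDist 1
    (Set.range fun z : ℝ × {ω : ℂ // 0 < ω.re} => kernelLaplace P p q z.1 z.2) := by
  rw [Metric.infDist_eq_iInf, iInf_range', penroseInf]
  simp only [dist_eq_norm]

/-- The values of the signal transforms `S[D_X P]`, extended to the closed upper half-plane, for all
`X`. -/
def signalValues (P : ℝ → ℝ) : Set ℂ :=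
  (fun z : ℝ × ℂ => signalExt (divDiff P z.1) z.2) '' {z | 0 ≤ z.2.im}

lemma closure_signalExt_image (P : 𝓢(ℝ, ℝ)) {s : Set (ℝ × ℂ)} (hs : s ⊆ {z | 0 ≤ z.2.im})
    (hs' : {z : ℝ × ℂ | 0 ≤ z.2.im} ⊆ closure s) :
    closure ((fun z : ℝ × ℂ => signalExt (divDiff P z.1) z.2) '' s) =
      closure (signalValues P) := by
  refine (closure_mono (Set.image_mono hs)).antisymm (closure_minimal ?_ isClosed_closure)
  have hclosed : IsClosed {z : ℝ × ℂ | 0 ≤ z.2.im} :=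
    isClosed_le continuous_const (Complex.continuous_im.comp continuous_snd)
  exact (Set.image_mono hs').trans (ContinuousOn.image_closure
    ((continuousOn_signalExt_divDiff P).mono (hclosed.closure_subset_iff.2 hs)))

lemma image_hilbertOff (P : 𝓢(ℝ, ℝ)) (S : Set ℝ) :
    (fun z : ℝ × ℂ => hilbertOff (divDiff P z.1) z.2) '' {z | z.1 ∈ S ∧ z.2.im ≠ 0} =
      (fun z : ℝ × ℂ => signalExt (divDiff P z.1) z.2) '' {z | z.1 ∈ S ∧ 0 < z.2.im} ∪
      conj '' ((fun z : ℝ × ℂ => signalExt (divDiff P z.1) z.2) ''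
        {z | z.1 ∈ S ∧ 0 < z.2.im}) := by
  have hupper (X : ℝ) {Ω : ℂ} (hΩ : 0 < Ω.im) := hilbertOff_eq_signalExt (integrable_divDiff P X) hΩ
  ext c
  constructor
  · rintro ⟨⟨X, Ω⟩, ⟨hX, hΩ⟩, rfl⟩
    obtain h | h := lt_or_gt_of_ne hΩ
    · have h' : 0 < (conj Ω).im := by simpa using h
      refine .inr ⟨_, ⟨(X, conj Ω), ⟨hX, h'⟩, rfl⟩, ?_⟩
      simp only [← hupper X h', hilbertOff_conj, Complex.conj_conj]
    · exact .inl ⟨(X, Ω), ⟨hX, h⟩, (hupper X h).symm⟩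
  · rintro (⟨⟨X, Ω⟩, ⟨hX, hΩ⟩, rfl⟩ | ⟨_, ⟨⟨X, Ω⟩, ⟨hX, hΩ⟩, rfl⟩, rfl⟩)
    · exact ⟨(X, Ω), ⟨hX, ne_of_gt hΩ⟩, hupper X hΩ⟩
    · refine ⟨(X, conj Ω), ⟨hX, by simpa using ne_of_gt hΩ⟩, ?_⟩
      simp only [hilbertOff_conj, hupper X hΩ]

lemma ofReal_mem_closure_union_conj_image_iff {s : Set ℂ} {c : ℝ} :
    (c : ℂ) ∈ closure (s ∪ conj '' s) ↔ (c : ℂ) ∈ closure s := by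
  have hconj : closure (conj '' s) = conj '' closure s :=
    (Complex.conjCLE.toHomeomorph.image_closure s).symm
  rw [closure_union, hconj, Set.union_def]
  refine ⟨?_, .inl⟩
  rintro (h | ⟨z, hz, hzc⟩)
  · exact h
  · rwa [← Complex.conj_ofReal, ← hzc, Complex.conj_conj]

lemma penroseInf_eq_zero_iff (P : 𝓢(ℝ, ℝ)) {p q : ℝ} (hp : p ≠ 0) (hq : q ≠ 0) :
    penroseInf P p q = 0 ↔ ((4 * Real.pi * p / q : ℝ) : ℂ) ∈ closure (signalValues P) := by
  have hfactor : ((q / (4 * Real.pi * p) : ℝ) : ℂ) ≠ 0 := by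
    rw [Complex.ofReal_ne_zero]
    have := Real.pi_ne_zero
    positivity
  have hinv : ((q / (4 * Real.pi * p) : ℝ) : ℂ)⁻¹ • (1 : ℂ) = (4 * Real.pi * p / q : ℝ) := by
    rw [smul_eq_mul, mul_one, ← Complex.ofReal_inv, inv_div]
  have hdense : {z : ℝ × ℂ | 0 ≤ z.2.im} ⊆ closure {z | z.1 ∈ ({0}ᶜ : Set ℝ) ∧ 0 < z.2.im} := by
    change _ ⊆ closure (({0}ᶜ : Set ℝ) ×ˢ {Ω : ℂ | 0 < Ω.im})
    rw [closure_prod_eq, closure_compl_singleton, Complex.closure_setOfPred_lt_im]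
    exact fun z hz => ⟨trivial, hz⟩
  have hrange : (Set.range fun z : ℝ × {ω : ℂ // 0 < ω.re} =>
      kernelLaplace P p q z.1 z.2).Nonempty := ⟨_, (0, ⟨1, by simp⟩), rfl⟩
  have himage := image_hilbertOff P {0}ᶜ
  simp only [Set.mem_compl_singleton_iff] at himage hdense
  rw [penroseInf_eq_infDist, ← Metric.mem_closure_iff_infDist_zero hrange,
    range_kernelLaplace P hp, Set.insert_eq, closure_union, closure_singleton,
    closure_smul₀, Set.mem_union, Set.mem_singleton_iff, or_iff_right one_ne_zero,
    Set.mem_smul_set_iff_inv_smul_mem₀ hfactor, hinv, himage,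
    ofReal_mem_closure_union_conj_image_iff,
    closure_signalExt_image P (fun z hz => hz.2.le) hdense]

end KernelLaplace

/-! ### Non-vanishing on the disc from a logarithm on the circle -/

section Disc

open Metric

lemma le_re_of_forall_mem_frontier_le_re {E : Type*} [NormedAddCommGroup E] [NormedSpace ℂ E]
    [Nontrivial E] {U : Set E} (hU : Bornology.IsBounded U) {F : E → ℂ} (hF : DiffContOnCl ℂ F U)
    {r : ℝ} (h : ∀ z ∈ frontier U, r ≤ (F z).re) {z : E} (hz : z ∈ closure U) : r ≤ (F z).re := by
  have hnorm (z : E) : ‖Complex.exp (-F z)‖ ≤ Real.exp (-r) ↔ r ≤ (F z).re := by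
    rw [Complex.norm_exp, Real.exp_le_exp, Complex.neg_re, neg_le_neg_iff]
  exact (hnorm z).1 (Complex.norm_le_of_forall_mem_frontier_norm_le hU
    (Complex.differentiable_exp.comp_diffContOnCl hF.neg) (fun z hz => (hnorm z).2 (h z hz)) hz)

lemma re_pos_of_re_pos_circle {F : ℂ → ℂ} (hF : DiffContOnCl ℂ F (ball 0 1))
    (h : ∀ w : Circle, 0 < (F w).re) {w : ℂ} (hw : w ∈ closedBall (0 : ℂ) 1) : 0 < (F w).re := by
  have hcont : Continuous fun w : Circle => (F w).re :=
    Complex.continuous_re.comp (hF.continuousOn_ball.comp_continuous continuous_subtype_val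
      fun w => mem_closedBall_zero_iff.2 w.norm_coe.le)
  obtain ⟨w₀, hmin⟩ := hcont.exists_forall_le_of_isBounded 1 (Bornology.IsBounded.all _)
  refine (h w₀).trans_le (le_re_of_forall_mem_frontier_le_re isBounded_ball hF
    (fun z hz => ?_) (by rwa [closure_ball _ one_ne_zero]))
  rw [frontier_ball _ one_ne_zero] at hz
  exact hmin ⟨z, by simpa [Submonoid.unitSphere] using hz⟩

lemma exists_entire_of_mem_span_fourier {f : C(UnitAddCircle, ℂ)}
    (hf : f ∈ Submodule.span ℂ (Set.range (@fourier (1 : ℝ)))) :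
    ∃ A B : ℂ → ℂ, Differentiable ℂ A ∧ Differentiable ℂ B ∧
      ∀ s : UnitAddCircle, f s = A s.toCircle + conj (B s.toCircle) := by
  induction hf using Submodule.span_induction with
  | mem f h =>
    obtain ⟨n, rfl⟩ := h
    have hfourier (s : UnitAddCircle) : fourier n s = (s.toCircle : ℂ) ^ n := by
      rw [fourier_apply, AddCircle.toCircle_zsmul, Circle.coe_zpow]
    obtain ⟨m, rfl | rfl⟩ := n.eq_nat_or_neg
    · exact ⟨fun w => w ^ m, fun _ => 0, by fun_prop, by fun_prop, fun s => by simp [hfourier]⟩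
    · refine ⟨fun _ => 0, fun w => w ^ m, by fun_prop, by fun_prop, fun s => ?_⟩
      rw [hfourier, zpow_neg, zpow_natCast, zero_add, map_pow, ← inv_pow, ← Circle.coe_inv,
        Circle.coe_inv_eq_conj]
  | zero => exact ⟨fun _ => 0, fun _ => 0, by fun_prop, by fun_prop, by simp⟩
  | add f g _ _ hf hg =>
    obtain ⟨A, B, hA, hB, h⟩ := hf
    obtain ⟨A', B', hA', hB', h'⟩ := hg
    refine ⟨A + A', B + B', hA.add hA', hB.add hB', fun s => ?_⟩
    simp only [ContinuousMap.add_apply, Pi.add_apply, h, h', map_add]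
    ring
  | smul c f _ hf =>
    obtain ⟨A, B, hA, hB, h⟩ := hf
    refine ⟨c • A, conj c • B, hA.const_smul c, hB.const_smul _, fun s => ?_⟩
    simp only [ContinuousMap.smul_apply, Pi.smul_apply, smul_eq_mul, h, map_mul, Complex.conj_conj]
    ring

/- A trigonometric polynomial within `1` of `l` is `A + conj B` for polynomials `A`, `B`, and
`l + B - A` then has imaginary part less than `1 < π / 2`. -/
lemma exists_entire_re_exp_pos (l : C(Circle, ℂ)) :
    ∃ H : ℂ → ℂ, Differentiable ℂ H ∧ ∀ w : Circle, 0 < (Complex.exp (l w + H w)).re := by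
  set f : C(UnitAddCircle, ℂ) := l.comp ⟨AddCircle.toCircle, AddCircle.continuous_toCircle⟩
  have hf : f ∈ (Submodule.span ℂ (Set.range (@fourier (1 : ℝ)))).topologicalClosure := by
    rw [span_fourier_closure_eq_top]
    trivial
  obtain ⟨g, hg, hfg⟩ := mem_closure_iff.1 hf 1 one_pos
  obtain ⟨A, B, hA, hB, h⟩ := exists_entire_of_mem_span_fourier hg
  refine ⟨B - A, hB.sub hA, fun w => ?_⟩
  obtain ⟨s, rfl⟩ := (AddCircle.homeomorphCircle (one_ne_zero (α := ℝ))).surjective w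
  rw [AddCircle.homeomorphCircle_apply]
  set w : Circle := s.toCircle
  have him : (l w + (B - A) w).im = (f s - g s).im := by
    have : f s = l w := rfl
    rw [h, this]
    simp only [Pi.sub_apply, Complex.add_im, Complex.sub_im, Complex.conj_im]
    ring
  have hlt : |(f s - g s).im| < 1 := (Complex.abs_im_le_norm _).trans_lt
    (((f - g).norm_coe_le_norm s).trans_lt (by rwa [← dist_eq_norm]))
  rw [abs_lt] at hlt
  rw [Complex.exp_re, him]
  exact mul_pos (Real.exp_pos _) (Real.cos_pos_of_mem_Ioo
    ⟨by linarith [Real.pi_gt_three], by linarith [Real.pi_gt_three]⟩)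

lemma ne_zero_of_eq_exp_on_circle {f : ℂ → ℂ} (hf : DiffContOnCl ℂ f (ball 0 1)) (l : C(Circle, ℂ))
    (h : ∀ w : Circle, f w = Complex.exp (l w)) {w : ℂ} (hw : w ∈ closedBall (0 : ℂ) 1) :
    f w ≠ 0 := by
  obtain ⟨H, hH, hpos⟩ := exists_entire_re_exp_pos l
  have hre := re_pos_of_re_pos_circle (hf.smul hH.cexp.diffContOnCl)
    (fun w => by simpa [h, ← Complex.exp_add] using hpos w) hw
  intro h0
  simp [h0] at hre

lemma eq_zero_of_eq_exp_mul_zpow_on_circle {f : ℂ → ℂ} (hf : DiffContOnCl ℂ f (ball 0 1))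
    (hne : ∀ w ∈ closedBall (0 : ℂ) 1, f w ≠ 0) (l : C(Circle, ℂ)) {n : ℤ}
    (h : ∀ w : Circle, f w = Complex.exp (l w) * w ^ n) : n = 0 := by
  wlog hn : n ≤ 0 generalizing f l n
  · refine neg_eq_zero.1 (this (hf.inv (by rwa [closure_ball _ one_ne_zero]))
      (fun w hw => inv_ne_zero (hne w hw)) (-l) (fun w => ?_) (by omega))
    rw [Pi.inv_apply, h, mul_inv, ← Complex.exp_neg, zpow_neg, ContinuousMap.neg_apply]
  obtain ⟨m, rfl⟩ := Int.exists_eq_neg_ofNat hn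
  have h0 := ne_zero_of_eq_exp_on_circle
    ((differentiable_id.pow m).diffContOnCl.smul hf) l (fun w => ?_)
    (mem_closedBall_self zero_le_one)
  · by_contra hm
    simp [show m ≠ 0 by simpa using hm] at h0
  · have := Circle.coe_ne_zero w
    simp only [id_eq, h, Pi.pow_apply, smul_eq_mul, zpow_neg, zpow_natCast]
    field_simp

end Disc

/-! ### Winding numbers of curves on the line -/

section Cayley

open Metric

/-- The Cayley transform, which maps the unit disc onto the upper half-plane and `1` to `∞`; as
division by zero gives zero, its value at `1` is `0`. -/
def cayley (w : ℂ) : ℂ := Complex.I * (1 + w) / (1 - w)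

lemma cayley_im (w : ℂ) : (cayley w).im = (1 - ‖w‖ ^ 2) / Complex.normSq (1 - w) := by
  rw [cayley, mul_div_assoc, Complex.I_mul_im, Complex.div_re, ← Complex.normSq_eq_norm_sq,
    Complex.normSq_apply w]
  simp
  ring

lemma cayley_im_nonneg {w : ℂ} (hw : w ∈ closedBall (0 : ℂ) 1) : 0 ≤ (cayley w).im := by
  rw [cayley_im]
  rw [mem_closedBall_zero_iff] at hw
  exact div_nonneg (by nlinarith [norm_nonneg w]) (Complex.normSq_nonneg _)

lemma cayley_im_pos {w : ℂ} (hw : w ∈ ball (0 : ℂ) 1) : 0 < (cayley w).im := by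
  rw [cayley_im]
  rw [mem_ball_zero_iff] at hw
  refine div_pos (by nlinarith [norm_nonneg w]) (Complex.normSq_pos.2 (sub_ne_zero.2 ?_))
  rintro rfl
  simp at hw

lemma ofReal_cayley_re (w : Circle) : ((cayley w).re : ℂ) = cayley w :=
  Complex.ext rfl (by simp [cayley_im, Circle.norm_coe])

lemma cayley_sub_I_div_add_I {Ω : ℂ} (hΩ : 0 ≤ Ω.im) :
    cayley ((Ω - Complex.I) / (Ω + Complex.I)) = Ω := by
  have hne : Ω + Complex.I ≠ 0 := fun h => by
    have : Ω.im + 1 = 0 := by simpa using congrArg Complex.im h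
    linarith
  have hadd : 1 + (Ω - Complex.I) / (Ω + Complex.I) = 2 * Ω / (Ω + Complex.I) := by
    field_simp
    ring
  have hsub : 1 - (Ω - Complex.I) / (Ω + Complex.I) = 2 * Complex.I / (Ω + Complex.I) := by
    field_simp
    ring
  have := Complex.I_ne_zero
  rw [cayley, hadd, hsub]
  field_simp

lemma exists_cayley_eq {Ω : ℂ} (hΩ : 0 < Ω.im) : ∃ w ∈ ball (0 : ℂ) 1, cayley w = Ω := by
  refine ⟨(Ω - Complex.I) / (Ω + Complex.I), ?_, cayley_sub_I_div_add_I hΩ.le⟩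
  have hlt : ‖Ω - Complex.I‖ < ‖Ω + Complex.I‖ := by
    rw [← sq_lt_sq₀ (norm_nonneg _) (norm_nonneg _), ← Complex.normSq_eq_norm_sq,
      ← Complex.normSq_eq_norm_sq, Complex.normSq_sub, Complex.normSq_add]
    simpa using by linarith
  rwa [mem_ball_zero_iff, norm_div, div_lt_one ((norm_nonneg _).trans_lt hlt)]

lemma differentiableAt_cayley {w : ℂ} (hw : w ≠ 1) : DifferentiableAt ℂ cayley w := by
  have : 1 - w ≠ 0 := sub_ne_zero.2 hw.symm
  unfold cayley
  fun_prop (disch := assumption)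

lemma tendsto_cayley_cobounded : Tendsto cayley (𝓝[≠] 1) (Bornology.cobounded ℂ) := by
  have hnum : Tendsto (fun w : ℂ => ‖Complex.I * (1 + w)‖) (𝓝[≠] 1) (𝓝 2) := by
    have : Continuous fun w : ℂ => ‖Complex.I * (1 + w)‖ := by fun_prop
    convert! (this.tendsto 1).mono_left nhdsWithin_le_nhds using 2
    norm_num
  have hden : Tendsto (fun w : ℂ => ‖(1 - w)⁻¹‖) (𝓝[≠] 1) atTop := by
    refine tendsto_norm_atTop_iff_cobounded.2 (tendsto_inv₀_nhdsNE_zero.comp ?_)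
    refine tendsto_nhdsWithin_iff.2 ⟨?_, ?_⟩
    · have : Continuous fun w : ℂ => 1 - w := by fun_prop
      simpa using (this.tendsto 1).mono_left nhdsWithin_le_nhds
    · filter_upwards [self_mem_nhdsWithin] with w hw using sub_ne_zero.2 (Ne.symm hw)
  rw [← tendsto_norm_atTop_iff_cobounded]
  exact (hnum.pos_mul_atTop two_pos hden).congr fun w => by
    rw [← norm_mul, cayley, div_eq_mul_inv]

/-- The inverse of the Cayley transform on the real line, a parametrisation of the unit circle
without `1`. -/
def lineToCircle (t : ℝ) : Circle := Circle.exp (Real.pi + 2 * Real.arctan t)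

lemma coe_lineToCircle (t : ℝ) :
    (lineToCircle t : ℂ) = (t - Complex.I) / (t + Complex.I) := by
  have hI := Complex.I_sq
  have hne : (t : ℂ) + Complex.I ≠ 0 := fun h => by simpa using congrArg Complex.im h
  have hadd : 1 + (t : ℂ) * Complex.I ≠ 0 := fun h => by simpa using congrArg Complex.re h
  have hsub : 1 - (t : ℂ) * Complex.I ≠ 0 := fun h => by simpa using congrArg Complex.re h
  have hexp : Complex.exp (2 * Complex.arctan t * Complex.I) =
      (1 + t * Complex.I) / (1 - t * Complex.I) := by
    rw [Complex.arctan]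
    nth_rw 2 [← Complex.exp_log (div_ne_zero hadd hsub)]
    congr 1
    linear_combination -Complex.log ((1 + t * Complex.I) / (1 - t * Complex.I)) * hI
  rw [lineToCircle, Circle.coe_exp]
  push_cast
  rw [add_mul, Complex.exp_add, Complex.exp_pi_mul_I, hexp]
  field_simp
  linear_combination (-2 * (t : ℂ)) * hI

lemma cayley_lineToCircle (t : ℝ) : cayley (lineToCircle t) = t := by
  rw [coe_lineToCircle, cayley_sub_I_div_add_I (by simp)]

lemma lineToCircle_ne_one (t : ℝ) : lineToCircle t ≠ 1 := fun h => by
  have hne : (t : ℂ) + Complex.I ≠ 0 := fun h => by simpa using congrArg Complex.im h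
  have heq : (t : ℂ) - Complex.I = t + Complex.I := by
    rw [← div_eq_one_iff_eq hne, ← coe_lineToCircle, h, Circle.coe_one]
  have him : (-1 : ℝ) = 1 := by simpa using congrArg Complex.im heq
  norm_num at him

lemma lineToCircle_cayley_re {w : Circle} (hw : w ≠ 1) : lineToCircle (cayley w).re = w := by
  have : 1 - (w : ℂ) ≠ 0 := sub_ne_zero.2 fun h => hw (Circle.ext h.symm)
  have hI := Complex.I_ne_zero
  refine Circle.ext ?_
  rw [coe_lineToCircle, ofReal_cayley_re, cayley]
  field_simp
  ring

lemma tendsto_cayley_re_cobounded :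
    Tendsto (fun w : Circle => (cayley w).re) (𝓝[≠] 1) (Bornology.cobounded ℝ) := by
  rw [← tendsto_norm_atTop_iff_cobounded]
  have hcoe : Tendsto ((↑) : Circle → ℂ) (𝓝[≠] 1) (𝓝[≠] 1) :=
    tendsto_nhdsWithin_iff.2 ⟨(continuous_subtype_val.tendsto (1 : Circle)).mono_left
      nhdsWithin_le_nhds, by
        filter_upwards [self_mem_nhdsWithin] with w hw using fun h => hw (Circle.ext h)⟩
  refine ((tendsto_norm_atTop_iff_cobounded.2 tendsto_cayley_cobounded).comp hcoe).congr fun w => ?_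
  change ‖cayley w‖ = ‖(cayley w).re‖
  rw [← Complex.norm_real, ofReal_cayley_re]

end Cayley

section Winding

open Metric

open Classical in
/-- The loop on the circle obtained by transplanting a curve `γ` on the line, whose common limit at
`±∞` is meant to be `b`. -/
def circleExt (γ : ℝ → ℂ) (b : ℂ) : Circle → ℂ :=
  Function.update (fun w : Circle => γ (cayley w).re) 1 b

lemma circleExt_one (γ : ℝ → ℂ) (b : ℂ) : circleExt γ b 1 = b := by
  classical
  rw [circleExt, Function.update_self]

lemma circleExt_lineToCircle (γ : ℝ → ℂ) (b : ℂ) (t : ℝ) :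
    circleExt γ b (lineToCircle t) = γ t := by
  classical
  rw [circleExt, Function.update_of_ne (lineToCircle_ne_one t), cayley_lineToCircle,
    Complex.ofReal_re]

lemma eq_one_or_exists_lineToCircle_eq (w : Circle) : w = 1 ∨ ∃ t, lineToCircle t = w :=
  or_iff_not_imp_left.2 fun hw => ⟨_, lineToCircle_cayley_re hw⟩

lemma continuous_circleExt {γ : ℝ → ℂ} (hγ : Continuous γ) {b : ℂ}
    (hb : Tendsto γ (cocompact ℝ) (𝓝 b)) : Continuous (circleExt γ b) := by
  classical
  rw [← continuousOn_univ, circleExt, continuousOn_update_iff, ← Set.compl_eq_univ_sdiff]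
  refine ⟨fun w hw => ContinuousAt.continuousWithinAt ?_, fun _ => ?_⟩
  · have hw' : (w : ℂ) ≠ 1 := fun h => hw (Circle.ext h)
    exact hγ.continuousAt.comp (Complex.continuous_re.continuousAt.comp
      ((differentiableAt_cayley hw').continuousAt.comp continuous_subtype_val.continuousAt))
  · rw [← cobounded_eq_cocompact] at hb
    exact hb.comp tendsto_cayley_re_cobounded

lemma exists_hasWindingNumber {γ : ℝ → ℂ} (hγ : Continuous γ) {b z : ℂ}
    (hb : Tendsto γ (cocompact ℝ) (𝓝 b)) (hz : z ∉ Set.range γ) (hzb : z ≠ b) :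
    ∃ n : ℤ, HasWindingNumber γ z n := by
  have hne (w : Circle) : circleExt γ b w - z ≠ 0 := by
    rw [sub_ne_zero]
    obtain rfl | ⟨t, rfl⟩ := eq_one_or_exists_lineToCircle_eq w
    · rw [circleExt_one]
      exact hzb.symm
    · rw [circleExt_lineToCircle]
      exact fun h => hz ⟨t, h⟩
  let loop : C(ℝ, {z : ℂ // z ≠ 0}) := ⟨fun θ => ⟨circleExt γ b (Circle.exp θ) - z, hne _⟩,
    (((continuous_circleExt hγ hb).comp Circle.exp.continuous).sub continuous_const).subtype_mk _⟩
  obtain ⟨Γ, ⟨-, hΓ⟩, -⟩ := Complex.isCoveringMap_exp.existsUnique_continuousMap_lifts loop 0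
    (Complex.log (loop 0)) (Subtype.ext (Complex.exp_log (loop 0).2))
  have hexp (θ : ℝ) : Complex.exp (Γ θ) = circleExt γ b (Circle.exp θ) - z :=
    congrArg Subtype.val (congrFun hΓ θ)
  obtain ⟨n, hn⟩ := Complex.exp_eq_exp_iff_exists_int.1
    ((hexp (2 * Real.pi)).trans (by rw [hexp 0, Circle.exp_two_pi, Circle.exp_zero]))
  have hlim {l : Filter ℝ} {a c : ℝ} (h : Tendsto Real.arctan l (𝓝 a)) (hc : Real.pi + 2 * a = c) :
      Tendsto (fun t => Γ (Real.pi + 2 * Real.arctan t)) l (𝓝 (Γ c)) :=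
    hc ▸ (Γ.continuous.tendsto _).comp ((h.const_mul 2).const_add Real.pi)
  refine ⟨n, fun t => Γ (Real.pi + 2 * Real.arctan t), ?_, fun t => ?_, Γ 0, ?_, ?_⟩
  · have := Real.continuous_arctan
    fun_prop
  · rw [hexp, ← lineToCircle, circleExt_lineToCircle]
  · exact hlim (Real.tendsto_arctan_atBot.mono_right nhdsWithin_le_nhds) (by ring)
  · convert! hlim (Real.tendsto_arctan_atTop.mono_right nhdsWithin_le_nhds)
      (c := 2 * Real.pi) (by ring) using 2
    rw [hn]
    ring

lemma HasWindingNumber.exists_circle_log {γ : ℝ → ℂ} {z : ℂ} {n : ℤ}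
    (h : HasWindingNumber γ z n) {b : ℂ} (hb : Tendsto γ (cocompact ℝ) (𝓝 b)) :
    ∃ l : C(Circle, ℂ), ∀ w, circleExt γ b w - z = Complex.exp (l w) * w ^ n := by
  obtain ⟨L, hL, hexp, a, hbot, htop⟩ := h
  rw [cocompact_eq_atBot_atTop, tendsto_sup] at hb
  have ha : b - z = Complex.exp a :=
    tendsto_nhds_unique ((hb.1.sub_const z).congr hexp)
      ((Complex.continuous_exp.tendsto a).comp hbot)
  -- subtracting `n` times the argument of `lineToCircle t` makes the two ends of `L` match
  set m : ℝ → ℂ := fun t => L t - n * (Real.pi + 2 * Real.arctan t : ℝ) * Complex.I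
  have hlim {l : Filter ℝ} {c d : ℝ} {a' : ℂ} (hL : Tendsto L l (𝓝 a'))
      (h : Tendsto Real.arctan l (𝓝 c)) (hd : Real.pi + 2 * c = d) :
      Tendsto m l (𝓝 (a' - n * d * Complex.I)) :=
    hd ▸ hL.sub (((Complex.continuous_ofReal.tendsto _).comp
      ((h.const_mul 2).const_add Real.pi)).const_mul _ |>.mul_const _)
  have hm : Tendsto m (cocompact ℝ) (𝓝 a) := by
    rw [cocompact_eq_atBot_atTop, tendsto_sup]
    constructor
    · simpa using hlim hbot (Real.tendsto_arctan_atBot.mono_right nhdsWithin_le_nhds)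
        (d := 0) (by ring)
    · convert! hlim htop (Real.tendsto_arctan_atTop.mono_right nhdsWithin_le_nhds)
        (d := 2 * Real.pi) (by ring) using 2
      push_cast
      ring
  have hmc : Continuous m := by
    have := Real.continuous_arctan
    fun_prop
  refine ⟨⟨circleExt m a, continuous_circleExt hmc hm⟩, fun w => ?_⟩
  rw [ContinuousMap.coe_mk]
  obtain rfl | ⟨t, rfl⟩ := eq_one_or_exists_lineToCircle_eq w
  · rw [circleExt_one, circleExt_one, ha, Circle.coe_one, one_zpow, mul_one]
  · rw [circleExt_lineToCircle, circleExt_lineToCircle, hexp, lineToCircle, Circle.coe_exp,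
      ← Complex.exp_int_mul, ← Complex.exp_add]
    congr 1
    simp only [m]
    ring

lemma hasWindingNumber_zero_of_slitPlane {γ : ℝ → ℂ} {b z : ℂ} (hγ : Continuous γ)
    (hb : Tendsto γ (cocompact ℝ) (𝓝 b)) (h : ∀ t, z - γ t ∈ Complex.slitPlane)
    (hzb : z - b ∈ Complex.slitPlane) : HasWindingNumber γ z 0 := by
  have hlog : Tendsto (fun t => Complex.log (z - γ t) + Real.pi * Complex.I) (cocompact ℝ)
      (𝓝 (Complex.log (z - b) + Real.pi * Complex.I)) :=
    ((tendsto_const_nhds.sub hb).clog hzb).add_const _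
  rw [cocompact_eq_atBot_atTop, tendsto_sup] at hlog
  refine ⟨_, ?_, fun t => ?_, _, hlog.1, ?_⟩
  · exact ((continuous_const.sub hγ).clog h).add_const _
  · rw [Complex.exp_add, Complex.exp_log (Complex.slitPlane_ne_zero (h t)), Complex.exp_pi_mul_I]
    ring
  · simpa using hlog.2

end Winding

/-! ### The argument principle in the upper half-plane -/

section UpperHalfPlane

open Metric

variable {F : ℂ → ℂ} {b z : ℂ}

/-- The function on the closed unit disc obtained by transplanting a function `F` on the closed
upper half-plane, whose limit at infinity is meant to be `b`. -/
def discExt (F : ℂ → ℂ) (b : ℂ) : ℂ → ℂ := Function.update (F ∘ cayley) 1 b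

lemma discExt_of_ne {w : ℂ} (hw : w ≠ 1) : discExt F b w = F (cayley w) :=
  Function.update_of_ne hw ..

lemma discExt_circle (w : Circle) : discExt F b w = circleExt (fun t => F t) b w := by
  obtain rfl | ⟨t, rfl⟩ := eq_one_or_exists_lineToCircle_eq w
  · rw [circleExt_one, discExt, Circle.coe_one, Function.update_self]
  · rw [circleExt_lineToCircle, discExt_of_ne fun h => lineToCircle_ne_one t (Circle.ext h),
      cayley_lineToCircle]

lemma diffContOnCl_discExt (hF : DiffContOnCl ℂ F {Ω | 0 < Ω.im})
    (hb : Tendsto F (cocompact ℂ ⊓ 𝓟 {Ω | 0 ≤ Ω.im}) (𝓝 b)) :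
    DiffContOnCl ℂ (discExt F b) (ball 0 1) := by
  constructor
  · have hne : ∀ w ∈ ball (0 : ℂ) 1, w ≠ 1 := by
      rintro w hw rfl
      simp at hw
    have hcayley : DifferentiableOn ℂ cayley (ball 0 1) := fun w hw =>
      (differentiableAt_cayley (hne w hw)).differentiableWithinAt
    exact (hF.differentiableOn.comp hcayley fun w hw => cayley_im_pos hw).congr
      fun w hw => discExt_of_ne (hne w hw)
  · have hF' : ContinuousOn F {Ω | 0 ≤ Ω.im} := by
      simpa only [Complex.closure_setOfPred_lt_im] using hF.continuousOn
    rw [closure_ball _ one_ne_zero, discExt, continuousOn_update_iff]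
    refine ⟨hF'.comp (fun w hw => (differentiableAt_cayley hw.2).continuousAt.continuousWithinAt)
      fun w hw => cayley_im_nonneg hw.1, fun _ => hb.comp (tendsto_inf.2 ⟨?_, ?_⟩)⟩
    · rw [← cobounded_eq_cocompact]
      exact tendsto_cayley_cobounded.mono_left (nhdsWithin_mono _ fun w hw => hw.2)
    · rw [tendsto_principal]
      filter_upwards [self_mem_nhdsWithin] with w hw using cayley_im_nonneg hw.1

lemma tendsto_ofReal_cocompact (hb : Tendsto F (cocompact ℂ ⊓ 𝓟 {Ω | 0 ≤ Ω.im}) (𝓝 b)) :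
    Tendsto (fun t : ℝ => F t) (cocompact ℝ) (𝓝 b) :=
  hb.comp (tendsto_inf.2 ⟨Complex.isometry_ofReal.isClosedEmbedding.tendsto_cocompact,
    tendsto_principal.2 (.of_forall fun _ => by simp)⟩)

lemma exists_discExt_log (hb : Tendsto F (cocompact ℂ ⊓ 𝓟 {Ω | 0 ≤ Ω.im}) (𝓝 b)) {n : ℤ}
    (h : HasWindingNumber (fun t : ℝ => F t) z n) :
    ∃ l : C(Circle, ℂ), ∀ w : Circle, discExt F b w - z = Complex.exp (l w) * w ^ n := by
  obtain ⟨l, hl⟩ := h.exists_circle_log (tendsto_ofReal_cocompact hb)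
  exact ⟨l, fun w => by rw [discExt_circle, hl]⟩

lemma ne_of_hasWindingNumber_zero (hF : DiffContOnCl ℂ F {Ω | 0 < Ω.im})
    (hb : Tendsto F (cocompact ℂ ⊓ 𝓟 {Ω | 0 ≤ Ω.im}) (𝓝 b))
    (h : HasWindingNumber (fun t : ℝ => F t) z 0) {Ω : ℂ} (hΩ : 0 < Ω.im) : F Ω ≠ z := by
  obtain ⟨l, hl⟩ := exists_discExt_log hb h
  obtain ⟨w, hw, rfl⟩ := exists_cayley_eq hΩ
  have hne := ne_zero_of_eq_exp_on_circle ((diffContOnCl_discExt hF hb).sub_const z) l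
    (by simpa using hl) (ball_subset_closedBall hw)
  rwa [discExt_of_ne (by rintro rfl; simp at hw), sub_ne_zero] at hne

lemma exists_eq_of_hasWindingNumber (hF : DiffContOnCl ℂ F {Ω | 0 < Ω.im})
    (hb : Tendsto F (cocompact ℂ ⊓ 𝓟 {Ω | 0 ≤ Ω.im}) (𝓝 b)) (hz : z ∉ Set.range fun t : ℝ => F t)
    (hzb : z ≠ b) {n : ℤ} (hn : n ≠ 0) (h : HasWindingNumber (fun t : ℝ => F t) z n) :
    ∃ Ω : ℂ, 0 < Ω.im ∧ F Ω = z := by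
  obtain ⟨l, hl⟩ := exists_discExt_log hb h
  by_contra! hno
  refine hn (eq_zero_of_eq_exp_mul_zpow_on_circle ((diffContOnCl_discExt hF hb).sub_const z)
    (fun w hw => sub_ne_zero.2 ?_) l hl)
  by_cases hw1 : w = 1
  · rw [hw1, discExt, Function.update_self]
    exact hzb.symm
  rw [discExt_of_ne hw1]
  obtain him | him := (cayley_im_nonneg hw).eq_or_lt
  · have hreal : ((cayley w).re : ℂ) = cayley w := Complex.ext rfl him
    exact fun h => hz ⟨(cayley w).re, (congrArg F hreal).trans h⟩
  · exact hno _ him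

lemma exists_hasWindingNumber_ne_zero_iff (hF : DiffContOnCl ℂ F {Ω | 0 < Ω.im})
    (hb : Tendsto F (cocompact ℂ ⊓ 𝓟 {Ω | 0 ≤ Ω.im}) (𝓝 b)) (hz : z ∉ Set.range fun t : ℝ => F t)
    (hzb : z ≠ b) : (∃ n : ℤ, n ≠ 0 ∧ HasWindingNumber (fun t : ℝ => F t) z n) ↔
      z ∈ F '' {Ω | 0 < Ω.im} := by
  refine ⟨fun ⟨n, hn, h⟩ => exists_eq_of_hasWindingNumber hF hb hz hzb hn h, ?_⟩
  rintro ⟨Ω, hΩ, rfl⟩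
  have hcont : Continuous fun t : ℝ => F t :=
    hF.continuousOn.comp_continuous Complex.continuous_ofReal fun t => by
      simp
  obtain ⟨n, hn⟩ := exists_hasWindingNumber hcont (tendsto_ofReal_cocompact hb) hz hzb
  refine ⟨n, ?_, hn⟩
  rintro rfl
  exact ne_of_hasWindingNumber_zero hF hb hn hΩ rfl

end UpperHalfPlane

/-! ### The enclosed regions -/

lemma tendsto_zero_of_norm_mul_norm_le {E F : Type*} [NormedAddCommGroup E] [ProperSpace E]
    [NormedAddCommGroup F] {f : E → F} {s : Set E} {C : ℝ} (h : ∀ z ∈ s, ‖z‖ * ‖f z‖ ≤ C) :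
    Tendsto f (cocompact E ⊓ 𝓟 s) (𝓝 0) := by
  have hnorm : Tendsto (fun z : E => ‖z‖) (cocompact E ⊓ 𝓟 s) atTop :=
    tendsto_norm_cocompact_atTop.mono_left inf_le_left
  refine squeeze_zero_norm' ?_ (hnorm.const_div_atTop C)
  filter_upwards [mem_inf_of_right (mem_principal_self s), hnorm.eventually_gt_atTop 0]
    with z hz hpos
  rw [le_div_iff₀' hpos]
  exact h z hz

lemma closure_image_subset_insert {E F : Type*} [TopologicalSpace E] [TopologicalSpace F]
    [T2Space F] {f : E → F} {s : Set E} {b : F} (hs : IsClosed s) (hf : ContinuousOn f s)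
    (hb : Tendsto f (cocompact E ⊓ 𝓟 s) (𝓝 b)) : closure (f '' s) ⊆ insert b (f '' s) := by
  have hlim : Tendsto (s.domRestrict f) (cocompact s) (𝓝 b) :=
    hb.comp (tendsto_inf.2 ⟨hs.isClosedEmbedding_subtypeVal.tendsto_cocompact,
      tendsto_principal.2 (.of_forall Subtype.property)⟩)
  rw [← Set.range_domRestrict]
  exact closure_minimal (Set.subset_insert _ _)
    (hlim.isCompact_insert_range_of_cocompact hf.domRestrict).isClosed

section HalfPlaneImage

variable {F : ℂ → ℂ} {b : ℂ}

lemma isOpen_image_or_image_subset_singleton (hF : DiffContOnCl ℂ F {Ω | 0 < Ω.im})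
    (hb : Tendsto F (cocompact ℂ ⊓ 𝓟 {Ω | 0 ≤ Ω.im}) (𝓝 b)) :
    IsOpen (F '' {Ω | 0 < Ω.im}) ∨ F '' {Ω | 0 < Ω.im} ⊆ {b} := by
  have hopen : IsOpen {Ω : ℂ | 0 < Ω.im} := isOpen_lt continuous_const Complex.continuous_im
  obtain ⟨w, hw⟩ | h := (hF.differentiableOn.analyticOnNhd hopen).is_constant_or_isOpen
    (convex_halfSpace_im_gt 0).isPreconnected
  · right
    have hup : Tendsto (fun y : ℝ => (y : ℂ) * Complex.I) atTop
        (cocompact ℂ ⊓ 𝓟 {Ω | 0 ≤ Ω.im}) := by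
      refine tendsto_inf.2 ⟨?_, tendsto_principal.2 ?_⟩
      · rw [← Metric.cobounded_eq_cocompact, ← tendsto_norm_atTop_iff_cobounded]
        simpa using tendsto_abs_atTop_atTop
      · filter_upwards [eventually_ge_atTop 0] with y hy
        simpa using hy
    have hwb : w = b := by
      refine tendsto_nhds_unique (tendsto_const_nhds.congr' ?_) (hb.comp hup)
      filter_upwards [eventually_gt_atTop 0] with y hy
      exact (hw _ (by simpa using hy)).symm
    rintro _ ⟨Ω, hΩ, rfl⟩
    exact (hw Ω hΩ).trans hwb
  · exact .inl (h _ subset_rfl hopen)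

lemma image_sdiff_singleton_subset_closure (hF : DiffContOnCl ℂ F {Ω | 0 < Ω.im})
    (hb : Tendsto F (cocompact ℂ ⊓ 𝓟 {Ω | 0 ≤ Ω.im}) (𝓝 b))
    (hγ : ContDiff ℝ 1 fun t : ℝ => F t) :
    F '' {Ω | 0 < Ω.im} \ {b} ⊆
      closure (F '' {Ω | 0 < Ω.im} \ ((Set.range fun t : ℝ => F t) ∪ {b})) := by
  obtain hopen | hsub := isOpen_image_or_image_subset_singleton hF hb
  · have hdense : Dense ((Set.range fun t : ℝ => F t) ∪ {b})ᶜ := by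
      rw [Set.compl_union]
      exact (hγ.dense_compl_range_of_finrank_lt_finrank (by simp)).sdiff_singleton b
    exact Set.sdiff_subset.trans (hdense.open_subset_closure_inter hopen)
  · exact fun z hz => (hz.2 (hsub hz.1)).elim

end HalfPlaneImage

section Enclosed

variable (P : 𝓢(ℝ, ℝ))

lemma tendsto_signalExt_divDiff_prod :
    Tendsto (fun z : ℝ × ℂ => signalExt (divDiff P z.1) z.2)
      (cocompact (ℝ × ℂ) ⊓ 𝓟 {z | 0 ≤ z.2.im}) (𝓝 0) :=
  have ⟨_, hC⟩ := exists_norm_mul_norm_signalExt_divDiff_le P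
  tendsto_zero_of_norm_mul_norm_le hC

lemma tendsto_signalExt_divDiff (X : ℝ) :
    Tendsto (signalExt (divDiff P X)) (cocompact ℂ ⊓ 𝓟 {Ω | 0 ≤ Ω.im}) (𝓝 0) :=
  have ⟨_, hC⟩ := exists_norm_mul_norm_signalExt_divDiff_le P
  tendsto_zero_of_norm_mul_norm_le fun Ω hΩ =>
    (mul_le_mul_of_nonneg_right (norm_snd_le (X, Ω)) (norm_nonneg _)).trans (hC (X, Ω) hΩ)

lemma diffContOnCl_signalExt_divDiff (X : ℝ) :
    DiffContOnCl ℂ (signalExt (divDiff P X)) {Ω | 0 < Ω.im} where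
  differentiableOn := differentiableOn_signalExt_divDiff P X
  continuousOn := by
    rw [Complex.closure_setOfPred_lt_im]
    exact continuousOn_signalExt (integrable_fourier_divDiff P X).integrableOn

lemma enclosed_eq (X : ℝ) :
    enclosed P X = signalExt (divDiff P X) '' {Ω | 0 < Ω.im} \ curveSet P X := by
  ext z
  have hsignal : signal (divDiff P X) = fun t : ℝ => signalExt (divDiff P X) t :=
    funext (signal_divDiff P X)
  rw [enclosed, curveSet, hsignal, Set.mem_ofPred_eq, Set.mem_sdiff, and_comm]
  refine and_congr_left fun hz => ?_
  rw [Set.mem_union, not_or] at hz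
  exact exists_hasWindingNumber_ne_zero_iff (diffContOnCl_signalExt_divDiff P X)
    (tendsto_signalExt_divDiff P X) hz.1 hz.2

lemma mem_enclosedClosure_iff {c : ℂ} (hc : c ≠ 0) :
    c ∈ enclosedClosure P ↔ c ∈ closure (signalValues P) := by
  set G := fun z : ℝ × ℂ => signalExt (divDiff P z.1) z.2
  have hdense : {z : ℝ × ℂ | 0 ≤ z.2.im} ⊆ closure {z | 0 < z.2.im} := by
    have : {z : ℝ × ℂ | 0 < z.2.im} = Set.univ ×ˢ {Ω : ℂ | 0 < Ω.im} := by ext; simp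
    rw [this, closure_prod_eq, closure_univ, Complex.closure_setOfPred_lt_im]
    exact fun z hz => ⟨trivial, hz⟩
  have hvalues : closure (G '' {z | 0 < z.2.im}) = closure (signalValues P) :=
    closure_signalExt_image P (Set.ofPred_subset_ofPred.2 fun _ => le_of_lt) hdense
  have hsub : G '' {z | 0 < z.2.im} \ {0} ⊆ enclosedClosure P := by
    rintro _ ⟨⟨⟨X, Ω⟩, hΩ, rfl⟩, h0⟩
    have hmem := image_sdiff_singleton_subset_closure (diffContOnCl_signalExt_divDiff P X)
      (tendsto_signalExt_divDiff P X) (contDiff_signalExt_divDiff_ofReal P X)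
      ⟨Set.mem_image_of_mem _ hΩ, h0⟩
    simp only [← signal_divDiff] at hmem
    rw [← curveSet, ← enclosed_eq] at hmem
    exact closure_mono (Set.subset_iUnion (enclosed P) X) hmem
  constructor
  · rw [← hvalues, enclosedClosure]
    refine fun h => closure_mono (Set.iUnion_subset fun X => ?_) h
    rw [enclosed_eq]
    rintro _ ⟨⟨Ω, hΩ, rfl⟩, -⟩
    exact ⟨(X, Ω), hΩ, rfl⟩
  · rw [← hvalues]
    exact fun h => closure_minimal hsub isClosed_closure
      (closure_sdiff ⟨h, by rwa [closure_singleton]⟩)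

lemma mem_closure_signalValues_iff {c : ℂ} (hc : c ≠ 0) :
    c ∈ closure (signalValues P) ↔ c ∈ signalValues P := by
  refine ⟨fun h => ?_, fun h => subset_closure h⟩
  exact (closure_image_subset_insert (isClosed_le continuous_const (by fun_prop))
    (continuousOn_signalExt_divDiff P) (tendsto_signalExt_divDiff_prod P) h).resolve_left hc

end Enclosed

/-! ### The stability criterion -/

lemma exists_add_eq_of_forall_le {f : ℝ → ℝ} (hf : Continuous f) {m : ℝ} (hm : ∀ t, f t ≤ f m)
    (X : ℝ) : ∃ t, f (t + X) = f t := by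
  have hcont : Continuous fun t => f (t + X) - f t := by fun_prop
  obtain ⟨t, ht⟩ := mem_range_of_exists_le_of_exists_ge hcont ⟨m, sub_nonpos.2 (hm (m + X))⟩
    ⟨m - X, by simpa using hm (m - X)⟩
  exact ⟨t, sub_eq_zero.1 ht⟩

lemma exists_add_eq_of_tendsto_cocompact {f : ℝ → ℝ} {a : ℝ} (hf : Continuous f)
    (ha : Tendsto f (cocompact ℝ) (𝓝 a)) (X : ℝ) : ∃ t, f (t + X) = f t := by
  obtain ⟨x, hx⟩ | h : (∃ x, a < f x) ∨ ∀ x, f x ≤ a := by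
    simpa only [not_exists, not_lt] using em (∃ x, a < f x)
  · obtain ⟨m, hm⟩ := hf.exists_forall_ge' x (ha.eventually (eventually_le_nhds hx))
    exact exists_add_eq_of_forall_le hf hm X
  obtain h0 | h0 := (h 0).eq_or_lt
  · exact exists_add_eq_of_forall_le hf (fun t => (h t).trans h0.ge) X
  · obtain ⟨m, hm⟩ := hf.exists_forall_le' 0 (ha.eventually (eventually_ge_nhds h0))
    obtain ⟨t, ht⟩ := exists_add_eq_of_forall_le hf.neg (fun t => neg_le_neg (hm t)) X
    exact ⟨t, neg_inj.1 ht⟩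

section Stability

variable (P : 𝓢(ℝ, ℝ))

lemma exists_divDiff_eq_zero {X : ℝ} (hX : X ≠ 0) : ∃ t, divDiff P X t = 0 := by
  obtain ⟨t, ht⟩ := exists_add_eq_of_tendsto_cocompact P.continuous
    P.tendsto_cocompact X
  refine ⟨t + X / 2, ?_⟩
  rw [divDiff, if_neg hX, add_assoc, add_halves, add_sub_cancel_right, ht, sub_self, zero_div]

variable {P}

lemma re_signalExt_divDiff (X t : ℝ) :
    (signalExt (divDiff P X) t).re = hilbert (divDiff P X) t := by
  simp [← signal_divDiff, signal]

lemma im_signalExt_divDiff (X t : ℝ) : (signalExt (divDiff P X) t).im = -divDiff P X t := by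
  simp [← signal_divDiff, signal]

lemma mem_signalValues_iff (c : ℝ) :
    (c : ℂ) ∈ signalValues P ↔
      (∃ (X : ℝ) (Ω : ℂ), Ω.im ≠ 0 ∧ hilbertOff (divDiff P X) Ω = c ∧
        hilbertOff (divDiff P X) (conj Ω) = c) ∨
      ∃ X Ω : ℝ, hilbert (divDiff P X) Ω = c ∧ divDiff P X Ω = 0 := by
  constructor
  · rintro ⟨⟨X, Ω⟩, (hΩ : 0 ≤ Ω.im), (h : signalExt (divDiff P X) Ω = c)⟩
    obtain him | him := hΩ.eq_or_lt
    · obtain ⟨t, rfl⟩ : ∃ t : ℝ, (t : ℂ) = Ω := ⟨Ω.re, Complex.ext rfl him⟩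
      refine .inr ⟨X, t, ?_, ?_⟩
      · simp [← re_signalExt_divDiff, h]
      · simp [← neg_eq_zero, ← im_signalExt_divDiff, h]
    · rw [← hilbertOff_eq_signalExt (integrable_divDiff P X) him] at h
      exact .inl ⟨X, Ω, him.ne', h, by rw [hilbertOff_conj, h, Complex.conj_ofReal]⟩
  · rintro (⟨X, Ω, him, h, h'⟩ | ⟨X, t, h, h'⟩)
    · obtain him | him := lt_or_gt_of_ne him
      · have hpos : 0 < (conj Ω).im := by simpa using him
        exact ⟨(X, conj Ω), hpos.le,
          (hilbertOff_eq_signalExt (integrable_divDiff P X) hpos).symm.trans h'⟩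
      · exact ⟨(X, Ω), him.le,
          (hilbertOff_eq_signalExt (integrable_divDiff P X) him).symm.trans h⟩
    · exact ⟨(X, t), by simp, Complex.ext (by simp [re_signalExt_divDiff, h])
        (by simp [im_signalExt_divDiff, h'])⟩

lemma nonneg_of_forall_hilbert_lt {c : ℝ}
    (h : ∀ X t : ℝ, divDiff P X t = 0 → hilbert (divDiff P X) t < c) : 0 ≤ c := by
  choose! t ht using fun X (hX : X ≠ 0) => exists_divDiff_eq_zero P hX
  have hesc : Tendsto (fun X : ℝ => (X, (t X : ℂ))) (cocompact ℝ)
      (cocompact (ℝ × ℂ) ⊓ 𝓟 {z | 0 ≤ z.2.im}) := by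
    refine tendsto_inf.2 ⟨?_, tendsto_principal.2 (.of_forall fun _ => by simp)⟩
    rw [← Metric.cobounded_eq_cocompact (α := ℝ × ℂ), ← tendsto_norm_atTop_iff_cobounded]
    exact tendsto_atTop_mono (fun X => norm_fst_le (X, (t X : ℂ))) tendsto_norm_cocompact_atTop
  have hlim : Tendsto (fun X => hilbert (divDiff P X) (t X)) (cocompact ℝ) (𝓝 0) := by
    simpa [Function.comp_def, re_signalExt_divDiff] using
      (Complex.continuous_re.tendsto 0).comp ((tendsto_signalExt_divDiff_prod P).comp hesc)
  refine le_of_tendsto hlim ?_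
  filter_upwards [(isCompact_singleton (x := (0 : ℝ))).compl_mem_cocompact] with X hX
  exact (h X _ (ht X hX)).le

lemma notMem_signalValues_of_forall_hilbert_lt {c : ℝ} (hc : c ≠ 0)
    (h : ∀ X t : ℝ, divDiff P X t = 0 → hilbert (divDiff P X) t < c) :
    (c : ℂ) ∉ signalValues P := by
  have hpos : 0 < c := (nonneg_of_forall_hilbert_lt h).lt_of_ne' hc
  rintro ⟨⟨X, Ω⟩, (hΩ : 0 ≤ Ω.im), (heq : signalExt (divDiff P X) Ω = c)⟩
  have hslit (t : ℝ) : c - signalExt (divDiff P X) t ∈ Complex.slitPlane := by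
    rw [Complex.mem_slitPlane_iff]
    by_cases h0 : divDiff P X t = 0
    · exact .inl (by simpa [re_signalExt_divDiff] using h X t h0)
    · exact .inr (by simpa [im_signalExt_divDiff] using h0)
  obtain him | him := hΩ.eq_or_lt
  · obtain ⟨t, rfl⟩ : ∃ t : ℝ, (t : ℂ) = Ω := ⟨Ω.re, Complex.ext rfl him⟩
    exact Complex.slitPlane_ne_zero (hslit t) (sub_eq_zero.2 heq.symm)
  · have hwind := hasWindingNumber_zero_of_slitPlane
      (contDiff_signalExt_divDiff_ofReal P X).continuous
      (tendsto_ofReal_cocompact (tendsto_signalExt_divDiff P X)) hslit (by simpa using hpos)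
    exact ne_of_hasWindingNumber_zero (diffContOnCl_signalExt_divDiff P X)
      (tendsto_signalExt_divDiff P X) hwind him heq

end Stability

end Alber

theorem theorem3p5_general (P : 𝓢(ℝ, ℝ)) (p q : ℝ) (hp : p ≠ 0) (hq : q ≠ 0) :
    (∀ X t : ℝ, Tendsto (Alber.hilbertTrunc (Alber.divDiff P X) t) (𝓝[>] 0)
      (𝓝 (Alber.hilbert (Alber.divDiff P X) t))) ∧
    List.TFAE [
      Alber.penroseInf P p q = 0,
      ¬ Alber.IsStable P p q,
      (∃ (X : ℝ) (Ω : ℂ), Ω.im ≠ 0 ∧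
          Alber.hilbertOff (Alber.divDiff P X) Ω = ((4 * Real.pi * p / q : ℝ) : ℂ) ∧
          Alber.hilbertOff (Alber.divDiff P X) (conj Ω) = ((4 * Real.pi * p / q : ℝ) : ℂ)) ∨
        (∃ X Ω : ℝ, Alber.hilbert (Alber.divDiff P X) Ω = 4 * Real.pi * p / q ∧
          Alber.divDiff P X Ω = 0),
      Metric.infEDist ((4 * Real.pi * p / q : ℝ) : ℂ) (Alber.enclosedClosure P) = 0] ∧
    ((∀ X t : ℝ, Alber.divDiff P X t = 0 →
        Alber.hilbert (Alber.divDiff P X) t < 4 * Real.pi * p / q) →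
      Alber.IsStable P p q) := by
  have hstable := Alber.not_isStable_iff P p q
  have hA := Alber.penroseInf_eq_zero_iff P hp hq
  have hc : 4 * Real.pi * p / q ≠ 0 := by
    have := Real.pi_ne_zero
    positivity
  have hc' : ((4 * Real.pi * p / q : ℝ) : ℂ) ≠ 0 := Complex.ofReal_ne_zero.2 hc
  have hvalues := hA.trans (Alber.mem_closure_signalValues_iff P hc')
  refine ⟨Alber.tendsto_hilbertTrunc_hilbert_divDiff P, ?_, fun h => ?_⟩
  · tfae_have 1 ↔ 2 := hstable.symm
    tfae_have 1 ↔ 3 := hvalues.trans (Alber.mem_signalValues_iff _)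
    tfae_have 1 ↔ 4 := by
      rw [hA, ← Alber.mem_enclosedClosure_iff P hc']
      exact Metric.mem_iff_infEDist_zero_of_closed isClosed_closure
    tfae_finish
  · rw [← not_not (a := Alber.IsStable P p q), hstable, hvalues]
    exact Alber.notMem_signalValues_of_forall_hilbert_lt hc h

/-- The first conjunct records that the principal values defining `H[D_X P]` on the real line
exist. The distance in (C) is the extended one, so that the empty set is at distance `∞`. -/
theorem theorem3p5 (P : 𝓢(ℝ, ℝ)) (hP : HasCompactSupport P) (p q : ℝ) (hp : p ≠ 0) (hq : q ≠ 0) :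
    (∀ X t : ℝ, Tendsto (Alber.hilbertTrunc (Alber.divDiff P X) t) (𝓝[>] 0)
      (𝓝 (Alber.hilbert (Alber.divDiff P X) t))) ∧
    List.TFAE [
      Alber.penroseInf P p q = 0,
      ¬ Alber.IsStable P p q,
      (∃ (X : ℝ) (Ω : ℂ), Ω.im ≠ 0 ∧
          Alber.hilbertOff (Alber.divDiff P X) Ω = ((4 * Real.pi * p / q : ℝ) : ℂ) ∧
          Alber.hilbertOff (Alber.divDiff P X) (conj Ω) = ((4 * Real.pi * p / q : ℝ) : ℂ)) ∨
        (∃ X Ω : ℝ, Alber.hilbert (Alber.divDiff P X) Ω = 4 * Real.pi * p / q ∧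
          Alber.divDiff P X Ω = 0),
      Metric.infEDist ((4 * Real.pi * p / q : ℝ) : ℂ) (Alber.enclosedClosure P) = 0] ∧
    ((∀ X t : ℝ, Alber.divDiff P X t = 0 →
        Alber.hilbert (Alber.divDiff P X) t < 4 * Real.pi * p / q) →
      Alber.IsStable P p q) :=
  theorem3p5_general P p q hp hq
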